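/- A \emph{quantum set} $\mathcal X$ is given by a set $\mathrm{At}(\mathcal X)$ of nonzero finite-dimensional complex Hilbert spaces, called its atoms. A \emph{binary relation} $R$ from $\mathcal X$ to $\mathcal Y$ assigns to each pair of atoms $X$ of $\mathcal X$ and $Y$ of $\mathcal Y$ a subspace $R(X,Y)\leq L(X,Y)$ of the space of linear operators from $X$ to $Y$. Composition is defined by $(S\circ R)(X,Z)=\mathrm{span}\{sr \mid s\in S(Y,Z),\ r\in R(X,Y)\text{ for some atom } Y \text{ of } \mathcal Y\}$; the identity $I_{\mathcal X}$ is defined by $I_{\mathcal X}(X,X)=\mathbb C\cdot 1_X$ and $I_{\mathcal X}(X,X')=0$ for $X\neq X'$; the adjoint is defined by $R^\dagger(Y,X)=\{v^\dagger\mid v\in R(X,Y)\}$; and $R\leq S$ means $R(X,Y)\leq S(X,Y)$ for all atoms $X$, $Y$. A \emph{function} from $\mathcal X$ to $\mathcal Y$ is a binary relation $F$ such that $F^\dagger\circ F\geq I_{\mathcal X}$ and $F\circ F^\dagger\leq I_{\mathcal Y}$. Let $\mathbf{qSet}$ be the category of quantum sets and functions. The \emph{Cartesian product} $\mathcal X\times\mathcal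 Y$ is the quantum set whose atoms are the tensor products $X\otimes Y$ for $X$ an atom of $\mathcal X$ and $Y$ an atom of $\mathcal Y$, with $(F\times G)(X\otimes Y,X'\otimes Y')=\mathrm{span}\{f\otimes g\mid f\in F(X,X'),\ g\in G(Y,Y')\}$ on functions. Let $\mathbf 1$ be the quantum set whose only atom is $\mathbb C$. \textbf{Theorem.} The category $\mathbf{qSet}$, equipped with the monoidal product $\times$, the unit $\mathbf 1$, and the associators, unitors and braidings spanned atomwise by the canonical unitary operators of Hilbert spaces, is a closed symmetric monoidal category. That is, it is a symmetric monoidal category, and for every quantum set $\mathcal X$ the functor $(-)\times\mathcal X\colon\mathbf{qSet}\to\mathbf{qSet}$ has a right adjoint $(-)^{\mathcal X}$. In particular, for all quantum sets $\mathcal X$ and $\mathcal Y$ there is a quantum function set $\mathcal Y^{\mathcal X}$. -/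

import Mathlib

open CategoryTheory
open scoped TensorProduct

universe u

noncomputable section

/-- A quantum set: a set of nonzero finite-dimensional complex Hilbert spaces, its atoms, given here
as a family `H` of Hilbert spaces indexed by an ordinary set `At`; distinct indices are distinct
atoms. -/
structure QuantumSet : Type (u + 1) where
  /-- The index set of the atoms. -/
  At : Type u
  /-- The atoms. -/
  H : At → Type u
  [normed : ∀ a, NormedAddCommGroup (H a)]
  [innerProductSpace : ∀ a, InnerProductSpace ℂ (H a)]
  [finiteDimensional : ∀ a, FiniteDimensional ℂ (H a)]
  [nontrivial : ∀ a, Nontrivial (H a)]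

namespace QuantumSet

attribute [instance] QuantumSet.normed QuantumSet.innerProductSpace QuantumSet.finiteDimensional
  QuantumSet.nontrivial

/-! ### Binary relations -/

/-- A binary relation from `X` to `Y`: a subspace of the space of linear operators `X.H a → Y.H b`
for every pair of atoms. (All linear operators are bounded, by finite-dimensionality.) The order is
the atomwise inclusion of subspaces. -/
abbrev Rel (X Y : QuantumSet.{u}) : Type u :=
  ∀ (a : X.At) (b : Y.At), Submodule ℂ (X.H a →ₗ[ℂ] Y.H b)

variable {W X Y Z : QuantumSet.{u}}

/-- The composition `S ∘ R` of binary relations, written in diagrammatic order. -/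
def Rel.comp (R : Rel X Y) (S : Rel Y Z) : Rel X Z := fun a c =>
  Submodule.span ℂ {t | ∃ b, ∃ s ∈ S b c, ∃ r ∈ R a b, t = s ∘ₗ r}

/-- The graph of a map of atoms `e` and operators `u a : X.H a → Y.H (e a)`:
it consists of these operators, as operators between the atoms `a` and `e a`. -/
inductive Graph (e : X.At → Y.At) (u : ∀ a, X.H a →ₗ[ℂ] Y.H (e a)) :
    ∀ (a : X.At) (b : Y.At), (X.H a →ₗ[ℂ] Y.H b) → Prop
  | mk (a : X.At) : Graph e u a (e a) (u a)

/-- The binary relation whose component at `(a, e a)` is spanned by the operator `u a`,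
the other components being zero (see `Rel.ofMaps_self`, `Rel.ofMaps_ne`). -/
def Rel.ofMaps (e : X.At → Y.At) (u : ∀ a, X.H a →ₗ[ℂ] Y.H (e a)) : Rel X Y := fun a b =>
  Submodule.span ℂ {v | Graph e u a b v}

theorem Rel.ofMaps_self (e : X.At → Y.At) (u : ∀ a, X.H a →ₗ[ℂ] Y.H (e a)) (a : X.At) :
    Rel.ofMaps e u a (e a) = ℂ ∙ u a := by
  have key : ∀ b (v : X.H a →ₗ[ℂ] Y.H b), Graph e u a b v → e a = b ∧ HEq v (u a) := by
    rintro b v ⟨⟩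
    exact ⟨rfl, HEq.rfl⟩
  unfold Rel.ofMaps
  congr 1
  ext v
  constructor
  · intro h
    exact eq_of_heq (key _ _ h).2
  · rintro rfl
    exact Graph.mk a

theorem Rel.ofMaps_ne (e : X.At → Y.At) (u : ∀ a, X.H a →ₗ[ℂ] Y.H (e a)) {a : X.At} {b : Y.At}
    (h : e a ≠ b) : Rel.ofMaps e u a b = ⊥ := by
  unfold Rel.ofMaps
  rw [Submodule.span_eq_bot]
  rintro v ⟨⟩
  exact absurd rfl h

/-- The identity relation: `I (a, a)` is spanned by the identity operator, and the other components
are zero. -/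
def Rel.id (X : QuantumSet.{u}) : Rel X X := Rel.ofMaps (fun a => a) fun _ => LinearMap.id

/-- The adjoint relation `R†`, with `R†(Y, X) = R(X, Y)†`. -/
def Rel.dagger (R : Rel X Y) : Rel Y X := fun b a =>
  (R a b).map (LinearMap.adjoint (𝕜 := ℂ) (E := X.H a) (F := Y.H b)).toLinearMap

theorem Rel.comp_mem {R : Rel X Y} {S : Rel Y Z} {a b c} {r : X.H a →ₗ[ℂ] Y.H b}
    {s : Y.H b →ₗ[ℂ] Z.H c} (hs : s ∈ S b c) (hr : r ∈ R a b) : s ∘ₗ r ∈ Rel.comp R S a c :=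
  Submodule.subset_span ⟨b, s, hs, r, hr, rfl⟩

theorem Rel.comp_le {R : Rel X Y} {S : Rel Y Z} {T : Rel X Z}
    (h : ∀ a b c, ∀ s ∈ S b c, ∀ r ∈ R a b, s ∘ₗ r ∈ T a c) : Rel.comp R S ≤ T := by
  intro a c
  refine Submodule.span_le.2 ?_
  rintro _ ⟨b, s, hs, r, hr, rfl⟩
  exact h a b c s hs r hr

theorem Rel.ofMaps_mem (e : X.At → Y.At) (u : ∀ a, X.H a →ₗ[ℂ] Y.H (e a)) (a : X.At) :
    u a ∈ Rel.ofMaps e u a (e a) :=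
  Submodule.subset_span (Graph.mk a)

theorem Rel.ofMaps_le {e : X.At → Y.At} {u : ∀ a, X.H a →ₗ[ℂ] Y.H (e a)} {T : Rel X Y}
    (h : ∀ a, u a ∈ T a (e a)) : Rel.ofMaps e u ≤ T := by
  intro a c
  refine Submodule.span_le.2 ?_
  rintro _ ⟨⟩
  exact h a

theorem Rel.id_mem (a : X.At) : LinearMap.id ∈ Rel.id X a a :=
  Rel.ofMaps_mem (fun a => a) (fun _ => LinearMap.id) a

/-- Induction on the generators of `Rel.ofMaps e u`. -/
theorem Rel.ofMaps_induction {e : X.At → Y.At} {u : ∀ a, X.H a →ₗ[ℂ] Y.H (e a)}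
    {P : ∀ a b, (X.H a →ₗ[ℂ] Y.H b) → Prop} (h : ∀ a, P a (e a) (u a))
    (h0 : ∀ a b, P a b 0) (hadd : ∀ a b v w, P a b v → P a b w → P a b (v + w))
    (hsmul : ∀ a b (z : ℂ) v, P a b v → P a b (z • v)) :
    ∀ a b, ∀ v ∈ Rel.ofMaps e u a b, P a b v := by
  intro a b v hv
  induction hv using Submodule.span_induction with
  | mem x hx => cases hx; exact h a
  | zero => exact h0 a b
  | add x y _ _ hx hy => exact hadd a b x y hx hy
  | smul z x _ hx => exact hsmul a b z x hx

theorem Rel.id_comp (R : Rel X Y) : Rel.comp (Rel.id X) R = R := by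
  refine le_antisymm (Rel.comp_le ?_) ?_
  · intro a b c s hs r hr
    revert c
    refine Rel.ofMaps_induction
      (P := fun a b r => ∀ c, ∀ s : X.H b →ₗ[ℂ] Y.H c, s ∈ R b c → s ∘ₗ r ∈ R a c)
      ?_ ?_ ?_ ?_ a b r hr
    · intro a c s hs; simpa using hs
    · intro a b c s hs; simp
    · intro a b v w hv hw c s hs
      rw [LinearMap.comp_add]; exact add_mem (hv c s hs) (hw c s hs)
    · intro a b z v hv c s hs
      rw [LinearMap.comp_smul]; exact Submodule.smul_mem _ _ (hv c s hs)
  · intro a c s hs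
    simpa using Rel.comp_mem hs (Rel.id_mem a)

theorem Rel.comp_id (R : Rel X Y) : Rel.comp R (Rel.id Y) = R := by
  refine le_antisymm (Rel.comp_le ?_) ?_
  · intro a b c s hs r hr
    refine Rel.ofMaps_induction
      (P := fun b c s => ∀ r : X.H a →ₗ[ℂ] Y.H b, r ∈ R a b → s ∘ₗ r ∈ R a c)
      ?_ ?_ ?_ ?_ b c s hs r hr
    · intro b s hs; simpa using hs
    · intro b c r hr; simp
    · intro b c v w hv hw r hr
      rw [LinearMap.add_comp]; exact add_mem (hv r hr) (hw r hr)
    · intro b c z v hv r hr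
      rw [LinearMap.smul_comp]; exact Submodule.smul_mem _ _ (hv r hr)
  · intro a c s hs
    simpa using Rel.comp_mem (Rel.id_mem c) hs

theorem Rel.comp_assoc (R : Rel W X) (S : Rel X Y) (T : Rel Y Z) :
    Rel.comp (Rel.comp R S) T = Rel.comp R (Rel.comp S T) := by
  refine le_antisymm (Rel.comp_le ?_) (Rel.comp_le ?_)
  · intro a c d t ht q hq
    induction hq using Submodule.span_induction with
    | mem x hx =>
      obtain ⟨b, s, hs, r, hr, rfl⟩ := hx
      rw [← LinearMap.comp_assoc]
      exact Rel.comp_mem (Rel.comp_mem ht hs) hr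
    | zero => simp
    | add x y _ _ hx hy => rw [LinearMap.comp_add]; exact add_mem hx hy
    | smul z x _ hx => rw [LinearMap.comp_smul]; exact Submodule.smul_mem _ _ hx
  · intro a b d q hq r hr
    induction hq using Submodule.span_induction with
    | mem x hx =>
      obtain ⟨c, t, ht, s, hs, rfl⟩ := hx
      rw [LinearMap.comp_assoc]
      exact Rel.comp_mem ht (Rel.comp_mem hs hr)
    | zero => simp
    | add x y _ _ hx hy => rw [LinearMap.add_comp]; exact add_mem hx hy
    | smul z x _ hx => rw [LinearMap.smul_comp]; exact Submodule.smul_mem _ _ hx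

/-- The category **qRel** of quantum sets and binary relations. -/
instance qRel : Category.{u} QuantumSet.{u} where
  Hom X Y := Rel X Y
  id X := Rel.id X
  comp R S := Rel.comp R S
  id_comp := Rel.id_comp
  comp_id := Rel.comp_id
  assoc := Rel.comp_assoc

/-! ### Functions -/

/-- A binary relation `F` is a function if `F† ∘ F ≥ I_X` and `F ∘ F† ≤ I_Y`. -/
def Rel.IsFunction (F : Rel X Y) : Prop :=
  Rel.id X ≤ Rel.comp F F.dagger ∧ Rel.comp F.dagger F ≤ Rel.id Y

theorem Rel.mem_dagger {R : Rel X Y} {a b} {v : Y.H b →ₗ[ℂ] X.H a} :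
    v ∈ R.dagger b a ↔ LinearMap.adjoint v ∈ R a b := by
  constructor
  · rintro ⟨w, hw, rfl⟩
    have : LinearMap.adjoint (LinearMap.adjoint w) = w := LinearMap.adjoint_adjoint w
    exact this.symm ▸ hw
  · intro h
    exact ⟨_, h, LinearMap.adjoint_adjoint v⟩

theorem Rel.adjoint_mem_dagger {R : Rel X Y} {a b} {v : X.H a →ₗ[ℂ] Y.H b} (hv : v ∈ R a b) :
    LinearMap.adjoint v ∈ R.dagger b a :=
  ⟨v, hv, rfl⟩

theorem Rel.dagger_dagger (R : Rel X Y) : R.dagger.dagger = R := by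
  funext a b
  ext v
  rw [Rel.mem_dagger, Rel.mem_dagger, LinearMap.adjoint_adjoint]

theorem Rel.dagger_mono {R S : Rel X Y} (h : R ≤ S) : R.dagger ≤ S.dagger := fun b a _ hv =>
  Rel.mem_dagger.2 (h a b (Rel.mem_dagger.1 hv))

theorem Rel.comp_mono {R R' : Rel X Y} {S S' : Rel Y Z} (h : R ≤ R') (h' : S ≤ S') :
    Rel.comp R S ≤ Rel.comp R' S' :=
  Rel.comp_le fun a b c _ hs _ hr => Rel.comp_mem (h' b c hs) (h a b hr)

theorem Rel.dagger_comp (R : Rel X Y) (S : Rel Y Z) :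
    (Rel.comp R S).dagger = Rel.comp S.dagger R.dagger := by
  have key : ∀ {X Y Z : QuantumSet.{u}} (R : Rel X Y) (S : Rel Y Z),
      Rel.comp S.dagger R.dagger ≤ (Rel.comp R S).dagger := by
    intro X Y Z R S
    refine Rel.comp_le fun c b a r hr s hs => ?_
    rw [Rel.mem_dagger, LinearMap.adjoint_comp]
    exact Rel.comp_mem (Rel.mem_dagger.1 hs) (Rel.mem_dagger.1 hr)
  refine le_antisymm ?_ (key R S)
  have h := Rel.dagger_mono (key S.dagger R.dagger)
  rwa [Rel.dagger_dagger, Rel.dagger_dagger, Rel.dagger_dagger] at h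

theorem Rel.IsFunction.comp {F : Rel X Y} {G : Rel Y Z} (hF : F.IsFunction) (hG : G.IsFunction) :
    (Rel.comp F G).IsFunction := by
  constructor
  · calc Rel.id X ≤ Rel.comp F F.dagger := hF.1
      _ = Rel.comp F (Rel.comp (Rel.id Y) F.dagger) := by rw [Rel.id_comp]
      _ ≤ Rel.comp F (Rel.comp (Rel.comp G G.dagger) F.dagger) :=
        Rel.comp_mono le_rfl (Rel.comp_mono hG.1 le_rfl)
      _ = Rel.comp (Rel.comp F G) (Rel.comp F G).dagger := by
        simp only [Rel.dagger_comp, Rel.comp_assoc]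
  · have h : Rel.comp (Rel.comp F G).dagger (Rel.comp F G) =
        Rel.comp G.dagger (Rel.comp (Rel.comp F.dagger F) G) := by
      simp only [Rel.dagger_comp, Rel.comp_assoc]
    rw [h]
    calc Rel.comp G.dagger (Rel.comp (Rel.comp F.dagger F) G)
      _ ≤ Rel.comp G.dagger (Rel.comp (Rel.id Y) G) :=
        Rel.comp_mono le_rfl (Rel.comp_mono hF.2 le_rfl)
      _ = Rel.comp G.dagger G := by rw [Rel.id_comp]
      _ ≤ Rel.id Z := hG.2

/-- A relation given by a bijection of atoms and unitary operators between corresponding atoms. -/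
def Rel.ofUnitary (e : X.At ≃ Y.At) (u : ∀ a, X.H a ≃ₗᵢ[ℂ] Y.H (e a)) : Rel X Y :=
  Rel.ofMaps e fun a => (u a).toLinearEquiv.toLinearMap

theorem adjoint_unitary {E F : Type*} [NormedAddCommGroup E] [InnerProductSpace ℂ E]
    [FiniteDimensional ℂ E] [NormedAddCommGroup F] [InnerProductSpace ℂ F] [FiniteDimensional ℂ F]
    (u : E ≃ₗᵢ[ℂ] F) :
    LinearMap.adjoint u.toLinearEquiv.toLinearMap = u.symm.toLinearEquiv.toLinearMap := by
  symm
  rw [LinearMap.eq_adjoint_iff]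
  intro x y
  have := u.inner_map_map (u.symm x) y
  simpa using this.symm

theorem Rel.ofUnitary_comp_dagger (e : X.At ≃ Y.At) (u : ∀ a, X.H a ≃ₗᵢ[ℂ] Y.H (e a)) :
    Rel.comp (Rel.ofUnitary e u) (Rel.ofUnitary e u).dagger = Rel.id X := by
  refine le_antisymm (Rel.comp_le ?_) (Rel.ofMaps_le ?_)
  · intro a b c s hs r hr
    rw [Rel.mem_dagger] at hs
    generalize hs' : LinearMap.adjoint s = s' at hs
    obtain rfl : LinearMap.adjoint s' = s := by rw [← hs', LinearMap.adjoint_adjoint]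
    clear hs'
    by_cases hab : e a = b
    · subst hab
      by_cases hca : e c = e a
      · obtain rfl := e.injective hca
        unfold Rel.ofUnitary at hr hs
        rw [Rel.ofMaps_self e, Submodule.mem_span_singleton] at hr hs
        obtain ⟨x, rfl⟩ := hr
        obtain ⟨y, rfl⟩ := hs
        rw [map_smulₛₗ, adjoint_unitary, LinearMap.comp_smul, LinearMap.smul_comp]
        refine Submodule.smul_mem _ _ (Submodule.smul_mem _ _ ?_)
        convert Rel.id_mem c
        ext x
        exact (u c).symm_apply_apply x
      · unfold Rel.ofUnitary at hs
        rw [Rel.ofMaps_ne e _ hca, Submodule.mem_bot] at hs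
        subst hs
        simp
    · unfold Rel.ofUnitary at hr
      rw [Rel.ofMaps_ne e _ hab, Submodule.mem_bot] at hr
      subst hr
      simp
  · intro a
    have h := Rel.ofMaps_mem e (fun a => (u a).toLinearEquiv.toLinearMap) a
    have := Rel.comp_mem (Rel.adjoint_mem_dagger h) h
    rw [adjoint_unitary] at this
    have h' : (u a).symm.toLinearEquiv.toLinearMap ∘ₗ (u a).toLinearEquiv.toLinearMap =
        LinearMap.id := LinearMap.ext fun x => (u a).symm_apply_apply x
    rwa [h'] at this

theorem Rel.dagger_comp_ofUnitary (e : X.At ≃ Y.At) (u : ∀ a, X.H a ≃ₗᵢ[ℂ] Y.H (e a)) :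
    Rel.comp (Rel.ofUnitary e u).dagger (Rel.ofUnitary e u) = Rel.id Y := by
  refine le_antisymm (Rel.comp_le ?_) (Rel.ofMaps_le ?_)
  · intro a b c s hs r hr
    rw [Rel.mem_dagger] at hr
    generalize hr' : LinearMap.adjoint r = r' at hr
    obtain rfl : LinearMap.adjoint r' = r := by rw [← hr', LinearMap.adjoint_adjoint]
    clear hr'
    by_cases hab : e b = a
    · subst hab
      by_cases hbc : e b = c
      · subst hbc
        unfold Rel.ofUnitary at hr hs
        rw [Rel.ofMaps_self e, Submodule.mem_span_singleton] at hr hs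
        obtain ⟨x, rfl⟩ := hr
        obtain ⟨y, rfl⟩ := hs
        rw [map_smulₛₗ, adjoint_unitary, LinearMap.comp_smul, LinearMap.smul_comp]
        refine Submodule.smul_mem _ _ (Submodule.smul_mem _ _ ?_)
        convert Rel.id_mem (e b)
        ext x
        exact (u b).apply_symm_apply x
      · unfold Rel.ofUnitary at hs
        rw [Rel.ofMaps_ne e _ hbc, Submodule.mem_bot] at hs
        subst hs
        simp
    · unfold Rel.ofUnitary at hr
      rw [Rel.ofMaps_ne e _ hab, Submodule.mem_bot] at hr
      subst hr
      simp
  · intro b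
    obtain ⟨a, rfl⟩ := e.surjective b
    have h := Rel.ofMaps_mem e (fun a => (u a).toLinearEquiv.toLinearMap) a
    have := Rel.comp_mem h (Rel.adjoint_mem_dagger h)
    rw [adjoint_unitary] at this
    have h' : (u a).toLinearEquiv.toLinearMap ∘ₗ (u a).symm.toLinearEquiv.toLinearMap =
        LinearMap.id := LinearMap.ext fun x => (u a).apply_symm_apply x
    rwa [h'] at this

theorem Rel.isFunction_ofUnitary (e : X.At ≃ Y.At) (u : ∀ a, X.H a ≃ₗᵢ[ℂ] Y.H (e a)) :
    (Rel.ofUnitary e u).IsFunction :=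
  ⟨(Rel.ofUnitary_comp_dagger e u).ge, (Rel.dagger_comp_ofUnitary e u).le⟩

theorem Rel.isFunction_dagger_ofUnitary (e : X.At ≃ Y.At) (u : ∀ a, X.H a ≃ₗᵢ[ℂ] Y.H (e a)) :
    (Rel.ofUnitary e u).dagger.IsFunction := by
  unfold Rel.IsFunction
  rw [Rel.dagger_dagger]
  exact ⟨(Rel.dagger_comp_ofUnitary e u).ge, (Rel.ofUnitary_comp_dagger e u).le⟩

theorem Rel.isFunction_id (X : QuantumSet.{u}) : (Rel.id X).IsFunction :=
  Rel.isFunction_ofUnitary (Equiv.refl X.At) fun a => LinearIsometryEquiv.refl ℂ (X.H a)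

/-- The functions, as a class of morphisms of **qRel**. -/
def functions : MorphismProperty QuantumSet.{u} := fun X Y F => Rel.IsFunction (X := X) (Y := Y) F

instance : functions.{u}.IsMultiplicative where
  id_mem := Rel.isFunction_id
  comp_mem _ _ hF hG := Rel.IsFunction.comp hF hG

end QuantumSet

/-- The category **qSet** of quantum sets and functions, a wide subcategory of **qRel**. -/
abbrev QSet : Type (u + 1) := WideSubcategory QuantumSet.functions.{u}

namespace QuantumSet

variable {X X' X'' Y Y' Y'' : QuantumSet.{u}}

/-! ### The Cartesian product -/

theorem nontrivial_tensor (E F : Type*) [NormedAddCommGroup E] [InnerProductSpace ℂ E]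
    [NormedAddCommGroup F] [InnerProductSpace ℂ F] [Nontrivial E] [Nontrivial F] :
    Nontrivial (E ⊗[ℂ] F) := by
  obtain ⟨x, hx⟩ := exists_ne (0 : E)
  obtain ⟨y, hy⟩ := exists_ne (0 : F)
  refine ⟨x ⊗ₜ y, 0, fun h => ?_⟩
  have : ‖x‖ * ‖y‖ = 0 := by rw [← TensorProduct.norm_tmul (𝕜 := ℂ), h, norm_zero]
  simp_all

/-- The Cartesian product of quantum sets: its atoms are the Hilbert space tensor products of an
atom of `X` with an atom of `Y`. -/
abbrev prod (X Y : QuantumSet.{u}) : QuantumSet.{u} where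
  At := X.At × Y.At
  H p := X.H p.1 ⊗[ℂ] Y.H p.2
  normed _ := inferInstance
  innerProductSpace _ := inferInstance
  finiteDimensional _ := inferInstance
  nontrivial _ := nontrivial_tensor _ _

/-- The monoidal unit **1**: its only atom is the one-dimensional Hilbert space `ℓ²({*})`. -/
abbrev unit : QuantumSet.{u} where
  At := PUnit
  H _ := EuclideanSpace ℂ PUnit.{u + 1}

/-- The Cartesian product of binary relations: `(R × S)(X ⊗ Y, X' ⊗ Y')` is the span of the
operators `r ⊗ s` with `r ∈ R(X, X')` and `s ∈ S(Y, Y')`. -/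
def Rel.prod (R : Rel X X') (S : Rel Y Y') : Rel (X.prod Y) (X'.prod Y') := fun p q =>
  Submodule.span ℂ {t : X.H p.1 ⊗[ℂ] Y.H p.2 →ₗ[ℂ] X'.H q.1 ⊗[ℂ] Y'.H q.2 |
    ∃ r ∈ R p.1 q.1, ∃ s ∈ S p.2 q.2, t = TensorProduct.map r s}

theorem Rel.prod_mem {R : Rel X X'} {S : Rel Y Y'} {p : (X.prod Y).At} {q : (X'.prod Y').At}
    {r : X.H p.1 →ₗ[ℂ] X'.H q.1} {s : Y.H p.2 →ₗ[ℂ] Y'.H q.2} (hr : r ∈ R p.1 q.1)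
    (hs : s ∈ S p.2 q.2) :
    (TensorProduct.map r s : X.H p.1 ⊗[ℂ] Y.H p.2 →ₗ[ℂ] X'.H q.1 ⊗[ℂ] Y'.H q.2) ∈
      Rel.prod R S p q :=
  Submodule.subset_span ⟨r, hr, s, hs, rfl⟩

theorem Rel.prod_le {R : Rel X X'} {S : Rel Y Y'} {T : Rel (X.prod Y) (X'.prod Y')}
    (h : ∀ (p : (X.prod Y).At) (q : (X'.prod Y').At), ∀ r ∈ R p.1 q.1, ∀ s ∈ S p.2 q.2,
      (TensorProduct.map r s : X.H p.1 ⊗[ℂ] Y.H p.2 →ₗ[ℂ] X'.H q.1 ⊗[ℂ] Y'.H q.2) ∈ T p q) :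
    Rel.prod R S ≤ T := by
  intro p q
  refine Submodule.span_le.2 ?_
  rintro _ ⟨r, hr, s, hs, rfl⟩
  exact h p q r hr s hs

theorem Rel.prod_mono {R R' : Rel X X'} {S S' : Rel Y Y'} (h : R ≤ R') (h' : S ≤ S') :
    Rel.prod R S ≤ Rel.prod R' S' :=
  Rel.prod_le fun _ _ _ hr _ hs => Rel.prod_mem (h _ _ hr) (h' _ _ hs)

theorem Rel.prod_id : Rel.prod (Rel.id X) (Rel.id Y) = Rel.id (X.prod Y) := by
  refine le_antisymm (Rel.prod_le ?_) (Rel.ofMaps_le ?_)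
  · rintro ⟨a, b⟩ ⟨a', b'⟩ r hr s hs
    refine Rel.ofMaps_induction (P := fun a a' r => ∀ b b' (s : Y.H b →ₗ[ℂ] Y.H b'),
      s ∈ Rel.id Y b b' →
      (TensorProduct.map r s : X.H a ⊗[ℂ] Y.H b →ₗ[ℂ] X.H a' ⊗[ℂ] Y.H b') ∈
        Rel.id (X.prod Y) (a, b) (a', b')) ?_ ?_ ?_ ?_ a a' r hr b b' s hs
    · intro a b b' s hs
      refine Rel.ofMaps_induction (P := fun b b' s =>
        (TensorProduct.map LinearMap.id s : X.H a ⊗[ℂ] Y.H b →ₗ[ℂ] X.H a ⊗[ℂ] Y.H b') ∈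
          Rel.id (X.prod Y) (a, b) (a, b')) ?_ ?_ ?_ ?_ b b' s hs
      · intro b
        rw [TensorProduct.map_id]
        exact Rel.id_mem (X := X.prod Y) (a, b)
      · intro b b'
        rw [TensorProduct.map_zero_right]; exact zero_mem _
      · intro b b' v w hv hw
        rw [TensorProduct.map_add_right]; exact add_mem hv hw
      · intro b b' z v hv
        rw [TensorProduct.map_smul_right]; exact Submodule.smul_mem _ _ hv
    · intro a a' b b' s hs
      rw [TensorProduct.map_zero_left]; exact zero_mem _
    · intro a a' v w hv hw b b' s hs
      rw [TensorProduct.map_add_left]; exact add_mem (hv b b' s hs) (hw b b' s hs)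
    · intro a a' z v hv b b' s hs
      rw [TensorProduct.map_smul_left]; exact Submodule.smul_mem _ _ (hv b b' s hs)
  · intro p
    have := Rel.prod_mem (p := p) (q := p) (Rel.id_mem p.1) (Rel.id_mem p.2)
    rwa [TensorProduct.map_id] at this

theorem Rel.prod_comp (R : Rel X X') (S : Rel Y Y') (R' : Rel X' X'') (S' : Rel Y' Y'') :
    Rel.prod (Rel.comp R R') (Rel.comp S S') = Rel.comp (Rel.prod R S) (Rel.prod R' S') := by
  refine le_antisymm (Rel.prod_le ?_) (Rel.comp_le ?_)
  · intro p q r hr s hs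
    induction hr using Submodule.span_induction with
    | mem x hx =>
      obtain ⟨b, r', hr', r, hr, rfl⟩ := hx
      induction hs using Submodule.span_induction with
      | mem x hx =>
        obtain ⟨c, s', hs', s, hs, rfl⟩ := hx
        rw [TensorProduct.map_comp]
        exact Rel.comp_mem (R := Rel.prod R S) (S := Rel.prod R' S') (b := (b, c))
          (Rel.prod_mem (p := (b, c)) (q := q) hr' hs')
          (Rel.prod_mem (p := p) (q := (b, c)) hr hs)
      | zero => rw [TensorProduct.map_zero_right]; exact zero_mem _
      | add x y _ _ hx hy => rw [TensorProduct.map_add_right]; exact add_mem hx hy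
      | smul z x _ hx => rw [TensorProduct.map_smul_right]; exact Submodule.smul_mem _ _ hx
    | zero => rw [TensorProduct.map_zero_left]; exact zero_mem _
    | add x y _ _ hx hy => rw [TensorProduct.map_add_left]; exact add_mem hx hy
    | smul z x _ hx => rw [TensorProduct.map_smul_left]; exact Submodule.smul_mem _ _ hx
  · intro p m q t ht t' ht'
    induction ht using Submodule.span_induction with
    | mem x hx =>
      obtain ⟨r', hr', s', hs', rfl⟩ := hx
      induction ht' using Submodule.span_induction with
      | mem x hx =>
        obtain ⟨r, hr, s, hs, rfl⟩ := hx
        have := Rel.prod_mem (p := p) (q := q) (Rel.comp_mem hr' hr) (Rel.comp_mem hs' hs)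
        rwa [TensorProduct.map_comp] at this
      | zero => rw [LinearMap.comp_zero]; exact zero_mem _
      | add x y _ _ hx hy => rw [LinearMap.comp_add]; exact add_mem hx hy
      | smul z x _ hx => rw [LinearMap.comp_smul]; exact Submodule.smul_mem _ _ hx
    | zero => rw [LinearMap.zero_comp]; exact zero_mem _
    | add x y _ _ hx hy => rw [LinearMap.add_comp]; exact add_mem hx hy
    | smul z x _ hx => rw [LinearMap.smul_comp]; exact Submodule.smul_mem _ _ hx

theorem Rel.prod_dagger (R : Rel X X') (S : Rel Y Y') :
    (Rel.prod R S).dagger = Rel.prod R.dagger S.dagger := by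
  have key : ∀ {X X' Y Y' : QuantumSet.{u}} (R : Rel X X') (S : Rel Y Y'),
      Rel.prod R.dagger S.dagger ≤ (Rel.prod R S).dagger := by
    intro X X' Y Y' R S
    refine Rel.prod_le fun p q r hr s hs => ?_
    have := Rel.adjoint_mem_dagger
      (Rel.prod_mem (p := q) (q := p) (Rel.mem_dagger.1 hr) (Rel.mem_dagger.1 hs))
    have h : LinearMap.adjoint (TensorProduct.map (LinearMap.adjoint r) (LinearMap.adjoint s)) =
        TensorProduct.map r s := by
      rw [TensorProduct.adjoint_map, LinearMap.adjoint_adjoint, LinearMap.adjoint_adjoint]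
    exact h ▸ this
  refine le_antisymm ?_ (key R S)
  have h := Rel.dagger_mono (key R.dagger S.dagger)
  rwa [Rel.dagger_dagger, Rel.dagger_dagger, Rel.dagger_dagger] at h

theorem Rel.IsFunction.prod {F : Rel X X'} {G : Rel Y Y'} (hF : F.IsFunction)
    (hG : G.IsFunction) : (Rel.prod F G).IsFunction := by
  constructor
  · rw [Rel.prod_dagger, ← Rel.prod_comp, ← Rel.prod_id]
    exact Rel.prod_mono hF.1 hG.1
  · rw [Rel.prod_dagger, ← Rel.prod_comp, ← Rel.prod_id]
    exact Rel.prod_mono hF.2 hG.2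

end QuantumSet

namespace QSet

open QuantumSet

/-- The isomorphism of **qSet** given by a bijection of atoms and unitary operators between
corresponding atoms. Its inverse is the adjoint relation. -/
def isoOfUnitary {X Y : QSet.{u}} (e : X.obj.At ≃ Y.obj.At)
    (u : ∀ a, X.obj.H a ≃ₗᵢ[ℂ] Y.obj.H (e a)) : X ≅ Y where
  hom := ⟨Rel.ofUnitary e u, Rel.isFunction_ofUnitary e u⟩
  inv := ⟨(Rel.ofUnitary e u).dagger, Rel.isFunction_dagger_ofUnitary e u⟩
  hom_inv_id := WideSubcategory.hom_ext _ (Rel.ofUnitary_comp_dagger e u)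
  inv_hom_id := WideSubcategory.hom_ext _ (Rel.dagger_comp_ofUnitary e u)

/-- The Cartesian product of functions. -/
def prodMap {X X' Y Y' : QSet.{u}} (F : X ⟶ X') (G : Y ⟶ Y') :
    (⟨X.obj.prod Y.obj⟩ : QSet.{u}) ⟶ ⟨X'.obj.prod Y'.obj⟩ :=
  ⟨Rel.prod (X := X.obj) (X' := X'.obj) (Y := Y.obj) (Y' := Y'.obj) F.hom G.hom,
    Rel.IsFunction.prod F.property G.property⟩

/-- The identification of `ℓ²({*})` with `ℂ`, evaluation at `*`. -/
def unitIsometry : EuclideanSpace ℂ PUnit.{u + 1} ≃ₗᵢ[ℂ] ℂ where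
  toFun x := x PUnit.unit
  invFun z := WithLp.toLp 2 fun _ => z
  map_add' _ _ := rfl
  map_smul' _ _ := rfl
  left_inv _ := rfl
  right_inv _ := rfl
  norm_map' x := by
    change ‖x PUnit.unit‖ = ‖x‖
    simp [EuclideanSpace.norm_eq]

/-- The Cartesian product on **qSet**, with its unit, and with the associators and unitors that
consist of the canonical unitary operators of Hilbert spaces
`(x ⊗ y) ⊗ z ↦ x ⊗ (y ⊗ z)`, `c ⊗ x ↦ c x`, `x ⊗ c ↦ c x`. -/
abbrev cartesian : MonoidalCategoryStruct QSet.{u} where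
  tensorObj X Y := ⟨X.obj.prod Y.obj⟩
  tensorUnit := ⟨QuantumSet.unit⟩
  tensorHom F G := prodMap F G
  whiskerLeft X _ _ G := prodMap (𝟙 X) G
  whiskerRight F Y := prodMap F (𝟙 Y)
  associator X Y Z := isoOfUnitary
    (Equiv.prodAssoc X.obj.At Y.obj.At Z.obj.At)
    fun a => TensorProduct.assocIsometry ℂ (X.obj.H a.1.1) (Y.obj.H a.1.2) (Z.obj.H a.2)
  leftUnitor X := isoOfUnitary
    (Equiv.punitProd X.obj.At)
    fun a => (TensorProduct.congrIsometry unitIsometry (.refl ℂ (X.obj.H a.2))).trans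
      (TensorProduct.lidIsometry ℂ (X.obj.H a.2))
  rightUnitor X := isoOfUnitary
    (Equiv.prodPUnit X.obj.At)
    fun a => (TensorProduct.congrIsometry (.refl ℂ (X.obj.H a.1)) unitIsometry).trans
      (TensorProduct.ridIsometry ℂ (X.obj.H a.1))

/-- The symmetry of the Cartesian product, which consists of the canonical unitary operators
`x ⊗ y ↦ y ⊗ x`. -/
def symmetry (X Y : QSet.{u}) : cartesian.tensorObj X Y ≅ cartesian.tensorObj Y X :=
  isoOfUnitary (X := ⟨X.obj.prod Y.obj⟩) (Y := ⟨Y.obj.prod X.obj⟩)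
    (Equiv.prodComm X.obj.At Y.obj.At)
    fun a => TensorProduct.commIsometry ℂ (X.obj.H a.1) (Y.obj.H a.2)

end QSet

end

/-! Monoidal structure. The order on functions is discrete (`Rel.IsFunction.eq_of_le`), so every
equation between functions needs only one inclusion, tested on generators. Each associator, unitor
and braiding consists of a single operator at each atom. Such relations are stable under composition
and product (`IsSpannedBy.comp`, `IsSpannedBy.prodMap`), so the coherence diagrams become identities
of linear maps on pure tensors.

Closedness. For fixed `X` and `Y`, it suffices to find a terminal object among the functions `G : W
× X → Y` with varying `W`. Call a Hilbert space `ℂⁿ⁺¹` with a function from its product with `X` to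
`Y` an action. The operators compatible with two such structures form `Rel.residual`, and they are
closed under composition and adjoints (`Rel.dagger_residual_le`), so they behave like intertwiners
of unitary representations. The atoms of `Y ^ X` are the irreducible actions, one for each
equivalence class.

The function `W → Y ^ X` induced by `G` is the residual of `G` by evaluation, the largest relation
`R` with `eval ∘ (R × I) ≤ G`. Complete reducibility (`id_mem_irreduciblePart`) gives `R† ∘ R ≥ I`,
and Schur's lemma gives `R ∘ R† ≤ I`, so `R` is a function. Discreteness of the order then turns the
defining inequality into an equality, and the maximality of `R` into uniqueness. -/

noncomputable section

/-! ### Discreteness of the order on functions, and relations with one generator per atom -/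

namespace QuantumSet

variable {W X Y Z X' Y' Z' : QuantumSet.{u}}

namespace Rel

/-- The reverse inclusion is `G ≤ G ∘ F† ∘ F ≤ G ∘ G† ∘ F ≤ F`. -/
theorem IsFunction.eq_of_le {F G : Rel X Y} (hF : F.IsFunction) (hG : G.IsFunction)
    (h : F ≤ G) : F = G := by
  refine le_antisymm h ?_
  calc G = Rel.comp (Rel.id X) G := (id_comp G).symm
    _ ≤ Rel.comp (Rel.comp F F.dagger) G := comp_mono hF.1 le_rfl
    _ = Rel.comp F (Rel.comp F.dagger G) := comp_assoc _ _ _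
    _ ≤ Rel.comp F (Rel.comp G.dagger G) := comp_mono le_rfl (comp_mono (dagger_mono h) le_rfl)
    _ ≤ Rel.comp F (Rel.id Y) := comp_mono le_rfl hG.2
    _ = F := comp_id F

theorem comp_ofMaps_le {R : Rel W X} {e : X.At → Y.At} {u : ∀ a, X.H a →ₗ[ℂ] Y.H (e a)}
    {T : Rel W Y} (h : ∀ a b, ∀ r ∈ R a b, u b ∘ₗ r ∈ T a (e b)) :
    comp R (ofMaps e u) ≤ T := by
  refine comp_le fun a b c s hs r hr => ?_
  refine ofMaps_induction (P := fun b c s => ∀ r : W.H a →ₗ[ℂ] X.H b, r ∈ R a b → s ∘ₗ r ∈ T a c)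
    ?_ ?_ ?_ ?_ b c s hs r hr
  · exact fun b r hr => h a b r hr
  · intro b c r _; simp
  · intro b c v w hv hw r hr
    rw [LinearMap.add_comp]; exact add_mem (hv r hr) (hw r hr)
  · intro b c z v hv r hr
    rw [LinearMap.smul_comp]; exact Submodule.smul_mem _ _ (hv r hr)

theorem ofMaps_comp_ofMaps (e : X.At → Y.At) (u : ∀ a, X.H a →ₗ[ℂ] Y.H (e a))
    (e' : Y.At → Z.At) (u' : ∀ b, Y.H b →ₗ[ℂ] Z.H (e' b)) :
    comp (ofMaps e u) (ofMaps e' u') = ofMaps (fun a => e' (e a)) fun a => u' (e a) ∘ₗ u a := by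
  refine le_antisymm (comp_ofMaps_le fun a b r hr => ?_) (ofMaps_le fun a => ?_)
  · refine ofMaps_induction (P := fun a b r => u' b ∘ₗ r ∈
      ofMaps (X := X) (Y := Z) (fun a => e' (e a)) (fun a => u' (e a) ∘ₗ u a) a (e' b))
      ?_ ?_ ?_ ?_ a b r hr
    · exact fun a => ofMaps_mem (X := X) (Y := Z) (fun a => e' (e a)) (fun a => u' (e a) ∘ₗ u a) a
    · intro a b; simp
    · intro a b v w hv hw
      rw [LinearMap.comp_add]; exact add_mem hv hw
    · intro a b z v hv
      rw [LinearMap.comp_smul]; exact Submodule.smul_mem _ _ hv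
  · exact comp_mem (ofMaps_mem e' u' (e a)) (ofMaps_mem e u a)

theorem prod_ofMaps (e : X.At → X'.At) (u : ∀ a, X.H a →ₗ[ℂ] X'.H (e a))
    (e' : Y.At → Y'.At) (u' : ∀ b, Y.H b →ₗ[ℂ] Y'.H (e' b)) :
    prod (ofMaps e u) (ofMaps e' u') = ofMaps (X := X.prod Y) (Y := X'.prod Y')
      (fun p => (e p.1, e' p.2)) fun p => TensorProduct.map (u p.1) (u' p.2) := by
  refine le_antisymm (prod_le ?_) (ofMaps_le fun p => prod_mem (p := p) (q := (e p.1, e' p.2))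
    (ofMaps_mem e u p.1) (ofMaps_mem e' u' p.2))
  rintro ⟨a, b⟩ ⟨a', b'⟩ r hr s hs
  refine ofMaps_induction (P := fun a a' r => ∀ b b' (s : Y.H b →ₗ[ℂ] Y'.H b'),
    s ∈ ofMaps e' u' b b' →
    (TensorProduct.map r s : X.H a ⊗[ℂ] Y.H b →ₗ[ℂ] X'.H a' ⊗[ℂ] Y'.H b') ∈
      ofMaps (X := X.prod Y) (Y := X'.prod Y') (fun p => (e p.1, e' p.2))
        (fun p => TensorProduct.map (u p.1) (u' p.2)) (a, b) (a', b'))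
    ?_ ?_ ?_ ?_ a a' r hr b b' s hs
  · intro a b b' s hs
    refine ofMaps_induction (P := fun b b' s =>
      (TensorProduct.map (u a) s : X.H a ⊗[ℂ] Y.H b →ₗ[ℂ] X'.H (e a) ⊗[ℂ] Y'.H b') ∈
        ofMaps (X := X.prod Y) (Y := X'.prod Y') (fun p => (e p.1, e' p.2))
          (fun p => TensorProduct.map (u p.1) (u' p.2)) (a, b) (e a, b')) ?_ ?_ ?_ ?_ b b' s hs
    · exact fun b => ofMaps_mem (X := X.prod Y) (Y := X'.prod Y') (fun p => (e p.1, e' p.2))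
        (fun p => TensorProduct.map (u p.1) (u' p.2)) (a, b)
    · intro b b'
      rw [TensorProduct.map_zero_right]; exact zero_mem _
    · intro b b' v w hv hw
      rw [TensorProduct.map_add_right]; exact add_mem hv hw
    · intro b b' z v hv
      rw [TensorProduct.map_smul_right]; exact Submodule.smul_mem _ _ hv
  · intro a a' b b' s hs
    rw [TensorProduct.map_zero_left]; exact zero_mem _
  · intro a a' v w hv hw b b' s hs
    rw [TensorProduct.map_add_left]; exact add_mem (hv b b' s hs) (hw b b' s hs)
  · intro a a' z v hv b b' s hs
    rw [TensorProduct.map_smul_left]; exact Submodule.smul_mem _ _ (hv b b' s hs)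

theorem mem_id_self {a : X.At} {r : X.H a →ₗ[ℂ] X.H a} :
    r ∈ Rel.id X a a ↔ ∃ z : ℂ, z • LinearMap.id = r := by
  unfold Rel.id
  rw [ofMaps_self (fun a => a), Submodule.mem_span_singleton]

/-- The linear map `φ` is there for the applications, where it is composition with a fixed operator
or tensoring with one. -/
theorem prod_induction {R : Rel X X'} {S : Rel Y Y'} {p : (X.prod Y).At} {q : (X'.prod Y').At}
    {V : Type*} [AddCommMonoid V] [Module ℂ V] (φ : (X.H p.1 ⊗[ℂ] Y.H p.2 →ₗ[ℂ]
      X'.H q.1 ⊗[ℂ] Y'.H q.2) →ₗ[ℂ] V) (T : Submodule ℂ V)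
    (h : ∀ r ∈ R p.1 q.1, ∀ s ∈ S p.2 q.2, φ (TensorProduct.map r s) ∈ T) :
    ∀ t ∈ prod R S p q, φ t ∈ T := by
  intro t ht
  have : prod R S p q ≤ T.comap φ := by
    refine Submodule.span_le.2 ?_
    rintro _ ⟨r, hr, s, hs, rfl⟩
    exact h r hr s hs
  exact this ht

end Rel

end QuantumSet

namespace QSet

open QuantumSet

variable {X Y Z X' Y' Z' : QSet.{u}}

theorem hom_ext_of_le {F G : X ⟶ Y} (h : LE.le (α := Rel X.obj Y.obj) F.hom G.hom) : F = G :=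
  WideSubcategory.hom_ext _ (Rel.IsFunction.eq_of_le F.property G.property h)

/-- The function `F` consists of the operators `u a` between the atoms `a` and `e a`. -/
def IsSpannedBy (F : X ⟶ Y) (e : X.obj.At → Y.obj.At)
    (u : ∀ a, X.obj.H a →ₗ[ℂ] Y.obj.H (e a)) : Prop :=
  F.hom = Rel.ofMaps e u

namespace IsSpannedBy

theorem id (X : QSet.{u}) : IsSpannedBy (𝟙 X) (fun a => a) fun _ => LinearMap.id := rfl

theorem comp {F : X ⟶ Y} {G : Y ⟶ Z} {e u e' u'} (hF : IsSpannedBy F e u)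
    (hG : IsSpannedBy G e' u') :
    IsSpannedBy (F ≫ G) (fun a => e' (e a)) fun a => u' (e a) ∘ₗ u a := by
  change Rel.comp F.hom G.hom = _
  rw [hF, hG, Rel.ofMaps_comp_ofMaps]

theorem prodMap {F : X ⟶ X'} {G : Y ⟶ Y'} {e u e' u'} (hF : IsSpannedBy F e u)
    (hG : IsSpannedBy G e' u') :
    IsSpannedBy (QSet.prodMap F G) (fun p => (e p.1, e' p.2))
      fun p => TensorProduct.map (u p.1) (u' p.2) := by
  change Rel.prod F.hom G.hom = _
  rw [hF, hG, Rel.prod_ofMaps]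

theorem eq {F G : X ⟶ Y} {e} {u u' : ∀ a, X.obj.H a →ₗ[ℂ] Y.obj.H (e a)}
    (hF : IsSpannedBy F e u) (hG : IsSpannedBy G e u') (h : ∀ a, u a = u' a) : F = G := by
  obtain rfl : u = u' := funext h
  exact WideSubcategory.hom_ext _ (hF.trans hG.symm)

/-- A one-sided inverse of an isomorphism is its inverse. This identifies an inverse that is defined
as an adjoint relation without computing adjoints. -/
theorem inv {i : X ≅ Y} {G : Y ⟶ X} {e' u'} (hG : IsSpannedBy G e' u')
    (h : G ≫ i.hom = 𝟙 Y) : IsSpannedBy i.inv e' u' := by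
  rwa [← Iso.comp_hom_eq_id i |>.1 h]

/-- Both sides are functions, so one inclusion suffices, and only the generators of `G` need
testing. All naturality squares are proved in this way. -/
theorem comp_eq {F : X ⟶ Y} {G : Y ⟶ Z} {H : X ⟶ Z} {e u} (hG : IsSpannedBy G e u)
    (h : ∀ a b, ∀ r ∈ (F.hom : Rel X.obj Y.obj) a b, u b ∘ₗ r ∈ (H.hom : Rel X.obj Z.obj) a (e b)) :
    F ≫ G = H := by
  apply hom_ext_of_le
  change Rel.comp F.hom G.hom ≤ _
  rw [hG]
  exact Rel.comp_ofMaps_le h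

end IsSpannedBy

open IsSpannedBy

/-! ### Coherence identities for linear maps -/

section Coherence

variable {A B C D : Type*} [AddCommGroup A] [AddCommGroup B] [AddCommGroup C] [AddCommGroup D]
  [Module ℂ A] [Module ℂ B] [Module ℂ C] [Module ℂ D]

theorem pentagon_maps :
    (TensorProduct.map LinearMap.id (TensorProduct.assoc ℂ B C D).toLinearMap ∘ₗ
      (TensorProduct.assoc ℂ A (B ⊗[ℂ] C) D).toLinearMap) ∘ₗ
        TensorProduct.map (TensorProduct.assoc ℂ A B C).toLinearMap LinearMap.id =
    (TensorProduct.assoc ℂ A B (C ⊗[ℂ] D)).toLinearMap ∘ₗ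
      (TensorProduct.assoc ℂ (A ⊗[ℂ] B) C D).toLinearMap := by
  ext
  simp

/-- The functional `u` stands for the identification of the atom of the unit with `ℂ`; only its
linearity matters. -/
theorem triangle_maps (u : C →ₗ[ℂ] ℂ) :
    TensorProduct.map LinearMap.id ((TensorProduct.lid ℂ B).toLinearMap ∘ₗ
        TensorProduct.map u LinearMap.id) ∘ₗ (TensorProduct.assoc ℂ A C B).toLinearMap =
    TensorProduct.map ((TensorProduct.rid ℂ A).toLinearMap ∘ₗ TensorProduct.map LinearMap.id u)
      LinearMap.id := by
  ext
  simp [TensorProduct.smul_tmul']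

theorem hexagon_maps :
    ((TensorProduct.assoc ℂ B C A).toLinearMap ∘ₗ (TensorProduct.comm ℂ A (B ⊗[ℂ] C)).toLinearMap) ∘ₗ
      (TensorProduct.assoc ℂ A B C).toLinearMap =
    (TensorProduct.map LinearMap.id (TensorProduct.comm ℂ A C).toLinearMap ∘ₗ
      (TensorProduct.assoc ℂ B A C).toLinearMap) ∘ₗ
        TensorProduct.map (TensorProduct.comm ℂ A B).toLinearMap LinearMap.id := by
  ext
  simp

theorem hexagon_symm_maps :
    ((TensorProduct.assoc ℂ C A B).symm.toLinearMap ∘ₗ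
      (TensorProduct.comm ℂ (A ⊗[ℂ] B) C).toLinearMap) ∘ₗ
        (TensorProduct.assoc ℂ A B C).symm.toLinearMap =
    (TensorProduct.map (TensorProduct.comm ℂ A C).toLinearMap LinearMap.id ∘ₗ
      (TensorProduct.assoc ℂ A C B).symm.toLinearMap) ∘ₗ
        TensorProduct.map LinearMap.id (TensorProduct.comm ℂ B C).toLinearMap := by
  ext
  simp

/-- The factor `z • id` is the general element of the identity relation at the atom of the unit. -/
theorem lid_naturality (u : C →ₗ[ℂ] ℂ) (z : ℂ) (s : A →ₗ[ℂ] B) :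
    ((TensorProduct.lid ℂ B).toLinearMap ∘ₗ TensorProduct.map u LinearMap.id) ∘ₗ
      TensorProduct.map (z • LinearMap.id) s =
    z • (s ∘ₗ (TensorProduct.lid ℂ A).toLinearMap ∘ₗ TensorProduct.map u LinearMap.id) := by
  ext
  simp [mul_smul]

theorem rid_naturality (u : C →ₗ[ℂ] ℂ) (z : ℂ) (s : A →ₗ[ℂ] B) :
    ((TensorProduct.rid ℂ B).toLinearMap ∘ₗ TensorProduct.map LinearMap.id u) ∘ₗ
      TensorProduct.map s (z • LinearMap.id) =
    z • (s ∘ₗ (TensorProduct.rid ℂ A).toLinearMap ∘ₗ TensorProduct.map LinearMap.id u) := by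
  ext
  simp

end Coherence

/-! ### The symmetric monoidal structure -/

theorem prodMap_id (X Y : QSet.{u}) : prodMap (𝟙 X) (𝟙 Y) = 𝟙 _ :=
  WideSubcategory.hom_ext _ Rel.prod_id

theorem prodMap_comp (F : X ⟶ Y) (G : Y ⟶ Z) (F' : X' ⟶ Y') (G' : Y' ⟶ Z') :
    prodMap F F' ≫ prodMap G G' = prodMap (F ≫ G) (F' ≫ G') :=
  WideSubcategory.hom_ext _ (Rel.prod_comp _ _ _ _).symm

theorem isSpannedBy_associator (X Y Z : QSet.{u}) :
    IsSpannedBy (cartesian.associator X Y Z).hom (fun a => (a.1.1, a.1.2, a.2))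
      fun _ => (TensorProduct.assoc ℂ _ _ _).toLinearMap := rfl

theorem isSpannedBy_symmetry (X Y : QSet.{u}) :
    IsSpannedBy (symmetry X Y).hom (fun a => (a.2, a.1))
      fun _ => (TensorProduct.comm ℂ _ _).toLinearMap := rfl

theorem isSpannedBy_leftUnitor (X : QSet.{u}) :
    IsSpannedBy (cartesian.leftUnitor X).hom (fun a => a.2)
      fun _ => (TensorProduct.lid ℂ _).toLinearMap ∘ₗ
        TensorProduct.map unitIsometry.toLinearEquiv.toLinearMap LinearMap.id := rfl

theorem isSpannedBy_rightUnitor (X : QSet.{u}) :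
    IsSpannedBy (cartesian.rightUnitor X).hom (fun a => a.1)
      fun _ => (TensorProduct.rid ℂ _).toLinearMap ∘ₗ
        TensorProduct.map LinearMap.id unitIsometry.toLinearEquiv.toLinearMap := rfl

theorem isSpannedBy_associator_inv (X Y Z : QSet.{u}) :
    IsSpannedBy (cartesian.associator X Y Z).inv (fun a => ((a.1, a.2.1), a.2.2))
      fun _ => (TensorProduct.assoc ℂ _ _ _).symm.toLinearMap := by
  let G : cartesian.tensorObj X (cartesian.tensorObj Y Z) ⟶
      cartesian.tensorObj (cartesian.tensorObj X Y) Z :=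
    (isoOfUnitary (X := cartesian.tensorObj X (cartesian.tensorObj Y Z))
      (Y := cartesian.tensorObj (cartesian.tensorObj X Y) Z)
      (Equiv.prodAssoc X.obj.At Y.obj.At Z.obj.At).symm
      fun a => (TensorProduct.assocIsometry ℂ (X.obj.H a.1) (Y.obj.H a.2.1) (Z.obj.H a.2.2)).symm).hom
  have hG : IsSpannedBy G (fun a => ((a.1, a.2.1), a.2.2))
      fun _ => (TensorProduct.assoc ℂ _ _ _).symm.toLinearMap := rfl
  have h := hG.comp (isSpannedBy_associator X Y Z)
  refine IsSpannedBy.inv hG (h.eq (.id _) ?_)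
  intro a
  exact (TensorProduct.assoc ℂ (X.obj.H a.1) (Y.obj.H a.2.1) (Z.obj.H a.2.2)).comp_symm

theorem associator_naturality (F : X ⟶ X') (G : Y ⟶ Y') (H : Z ⟶ Z') :
    prodMap (prodMap F G) H ≫ (cartesian.associator X' Y' Z').hom =
      (cartesian.associator X Y Z).hom ≫ prodMap F (prodMap G H) := by
  refine (isSpannedBy_associator X' Y' Z').comp_eq fun p q => ?_
  refine Rel.prod_induction (X := X.obj.prod Y.obj) (X' := X'.obj.prod Y'.obj) (Y := Z.obj)
    (Y' := Z'.obj) (p := p) (q := q)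
    (LinearMap.compRight ℂ (TensorProduct.assoc ℂ _ _ _).toLinearMap) _ ?_
  intro r hr t ht
  revert r
  -- The inner product is unpacked with `t` fixed, along the linear map sending `v` to the
  -- associator after `v ⊗ t`.
  refine Rel.prod_induction (X := X.obj) (X' := X'.obj) (Y := Y.obj) (Y' := Y'.obj)
    (p := p.1) (q := q.1)
    ((LinearMap.compRight ℂ (TensorProduct.assoc ℂ _ _ _).toLinearMap) ∘ₗ
      (TensorProduct.mapBilinear (RingHom.id ℂ) _ _ _ _).flip t) _ ?_
  intro r hr s hs
  have h := Rel.comp_mem (X := (X.obj.prod Y.obj).prod Z.obj) (Y := X.obj.prod (Y.obj.prod Z.obj))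
    (Z := X'.obj.prod (Y'.obj.prod Z'.obj)) (a := p) (b := (p.1.1, p.1.2, p.2))
    (c := (q.1.1, q.1.2, q.2)) (S := Rel.prod F.hom (Rel.prod G.hom H.hom))
    (Rel.prod_mem (Y := Y.obj.prod Z.obj) (Y' := Y'.obj.prod Z'.obj) hr
      (Rel.prod_mem (p := (p.1.2, p.2)) (q := (q.1.2, q.2)) hs ht))
    (Rel.ofMaps_mem (X := (X.obj.prod Y.obj).prod Z.obj) (Y := X.obj.prod (Y.obj.prod Z.obj))
      (fun a => (a.1.1, a.1.2, a.2)) (fun _ => (TensorProduct.assoc ℂ _ _ _).toLinearMap) p)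
  rw [TensorProduct.map_map_comp_assoc_eq] at h
  exact h

theorem leftUnitor_naturality (F : X ⟶ Y) :
    prodMap (𝟙 cartesian.tensorUnit) F ≫ (cartesian.leftUnitor Y).hom =
      (cartesian.leftUnitor X).hom ≫ F := by
  refine (isSpannedBy_leftUnitor Y).comp_eq fun p q => ?_
  refine Rel.prod_induction (X := unit) (X' := unit) (Y := X.obj) (Y' := Y.obj) (p := p) (q := q)
    (LinearMap.compRight ℂ _) _ ?_
  intro r hr s hs
  obtain ⟨z, rfl⟩ := Rel.mem_id_self.1 hr
  have h := Rel.comp_mem (X := unit.prod X.obj) (Y := X.obj) hs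
    (Rel.ofMaps_mem (X := unit.prod X.obj) (Y := X.obj) (fun a => a.2)
      (fun a => (TensorProduct.lid ℂ (X.obj.H a.2)).toLinearMap ∘ₗ
        TensorProduct.map unitIsometry.toLinearEquiv.toLinearMap LinearMap.id) p)
  change _ ∘ₗ _ ∈ _
  rw [lid_naturality]
  exact Submodule.smul_mem _ z h

theorem rightUnitor_naturality (F : X ⟶ Y) :
    prodMap F (𝟙 cartesian.tensorUnit) ≫ (cartesian.rightUnitor Y).hom =
      (cartesian.rightUnitor X).hom ≫ F := by
  refine (isSpannedBy_rightUnitor Y).comp_eq fun p q => ?_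
  refine Rel.prod_induction (Y := unit) (Y' := unit) (X := X.obj) (X' := Y.obj) (p := p) (q := q)
    (LinearMap.compRight ℂ _) _ ?_
  intro s hs r hr
  obtain ⟨z, rfl⟩ := Rel.mem_id_self.1 hr
  have h := Rel.comp_mem (X := X.obj.prod unit) (Y := X.obj) hs
    (Rel.ofMaps_mem (X := X.obj.prod unit) (Y := X.obj) (fun a => a.1)
      (fun a => (TensorProduct.rid ℂ (X.obj.H a.1)).toLinearMap ∘ₗ
        TensorProduct.map LinearMap.id unitIsometry.toLinearEquiv.toLinearMap) p)
  change _ ∘ₗ _ ∈ _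
  rw [rid_naturality]
  exact Submodule.smul_mem _ z h

theorem symmetry_naturality (F : X ⟶ X') (G : Y ⟶ Y') :
    prodMap F G ≫ (symmetry X' Y').hom = (symmetry X Y).hom ≫ prodMap G F := by
  refine (isSpannedBy_symmetry X' Y').comp_eq fun p q => ?_
  refine Rel.prod_induction (X := X.obj) (X' := X'.obj) (Y := Y.obj) (Y' := Y'.obj)
    (p := p) (q := q) (LinearMap.compRight ℂ (TensorProduct.comm ℂ _ _).toLinearMap) _ ?_
  intro r hr s hs
  have h := Rel.comp_mem (X := X.obj.prod Y.obj) (Y := Y.obj.prod X.obj)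
    (Z := Y'.obj.prod X'.obj) (a := p) (b := (p.2, p.1)) (c := (q.2, q.1))
    (S := Rel.prod G.hom F.hom)
    (Rel.prod_mem (p := (p.2, p.1)) (q := (q.2, q.1)) hs hr)
    (Rel.ofMaps_mem (X := X.obj.prod Y.obj) (Y := Y.obj.prod X.obj)
      (fun a => (a.2, a.1)) (fun _ => (TensorProduct.comm ℂ _ _).toLinearMap) p)
  have e : (TensorProduct.comm ℂ (X'.obj.H q.1) (Y'.obj.H q.2)).toLinearMap ∘ₗ
      TensorProduct.map r s =
      TensorProduct.map s r ∘ₗ (TensorProduct.comm ℂ (X.obj.H p.1) (Y.obj.H p.2)).toLinearMap :=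
    TensorProduct.ext' fun x y => rfl
  change _ ∘ₗ _ ∈ _
  rw [e]
  exact h

variable (W X Y Z : QSet.{u})

theorem pentagon :
    prodMap (cartesian.associator W X Y).hom (𝟙 Z) ≫
      (cartesian.associator W (cartesian.tensorObj X Y) Z).hom ≫
        prodMap (𝟙 W) (cartesian.associator X Y Z).hom =
    (cartesian.associator (cartesian.tensorObj W X) Y Z).hom ≫
      (cartesian.associator W X (cartesian.tensorObj Y Z)).hom := by
  rw [← Category.assoc]
  have h := (((isSpannedBy_associator W X Y).prodMap (.id Z)).comp
    (isSpannedBy_associator W (cartesian.tensorObj X Y) Z)).comp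
      ((IsSpannedBy.id W).prodMap (isSpannedBy_associator X Y Z))
  have h' := (isSpannedBy_associator (cartesian.tensorObj W X) Y Z).comp
    (isSpannedBy_associator W X (cartesian.tensorObj Y Z))
  refine h.eq h' ?_
  intro a
  exact pentagon_maps (A := W.obj.H a.1.1.1) (B := X.obj.H a.1.1.2) (C := Y.obj.H a.1.2)
    (D := Z.obj.H a.2)

theorem triangle :
    (cartesian.associator X cartesian.tensorUnit Y).hom ≫
      prodMap (𝟙 X) (cartesian.leftUnitor Y).hom =
    prodMap (cartesian.rightUnitor X).hom (𝟙 Y) := by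
  have h := (isSpannedBy_associator X cartesian.tensorUnit Y).comp
    ((IsSpannedBy.id X).prodMap (isSpannedBy_leftUnitor Y))
  have h' := (isSpannedBy_rightUnitor X).prodMap (.id Y)
  refine h.eq h' ?_
  intro a
  exact triangle_maps (A := X.obj.H a.1.1) (B := Y.obj.H a.2)
    unitIsometry.toLinearEquiv.toLinearMap

theorem hexagon :
    (cartesian.associator X Y Z).hom ≫ (symmetry X (cartesian.tensorObj Y Z)).hom ≫
      (cartesian.associator Y Z X).hom =
    prodMap (symmetry X Y).hom (𝟙 Z) ≫ (cartesian.associator Y X Z).hom ≫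
      prodMap (𝟙 Y) (symmetry X Z).hom := by
  have h := (isSpannedBy_associator X Y Z).comp
    ((isSpannedBy_symmetry X (cartesian.tensorObj Y Z)).comp (isSpannedBy_associator Y Z X))
  have h' := ((isSpannedBy_symmetry X Y).prodMap (.id Z)).comp
    ((isSpannedBy_associator Y X Z).comp ((IsSpannedBy.id Y).prodMap (isSpannedBy_symmetry X Z)))
  refine h.eq h' ?_
  intro a
  exact hexagon_maps (A := X.obj.H a.1.1) (B := Y.obj.H a.1.2) (C := Z.obj.H a.2)

theorem hexagon_symm :
    (cartesian.associator X Y Z).inv ≫ (symmetry (cartesian.tensorObj X Y) Z).hom ≫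
      (cartesian.associator Z X Y).inv =
    prodMap (𝟙 X) (symmetry Y Z).hom ≫ (cartesian.associator X Z Y).inv ≫
      prodMap (symmetry X Z).hom (𝟙 Y) := by
  have h := (isSpannedBy_associator_inv X Y Z).comp
    ((isSpannedBy_symmetry (cartesian.tensorObj X Y) Z).comp (isSpannedBy_associator_inv Z X Y))
  have h' := ((IsSpannedBy.id X).prodMap (isSpannedBy_symmetry Y Z)).comp
    ((isSpannedBy_associator_inv X Z Y).comp ((isSpannedBy_symmetry X Z).prodMap (.id Y)))
  refine h.eq h' ?_
  intro a
  exact hexagon_symm_maps (A := X.obj.H a.1) (B := Y.obj.H a.2.1) (C := Z.obj.H a.2.2)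

theorem symmetry_comp_symmetry : (symmetry X Y).hom ≫ (symmetry Y X).hom = 𝟙 _ := by
  have h := (isSpannedBy_symmetry X Y).comp (isSpannedBy_symmetry Y X)
  refine h.eq (.id _) ?_
  intro a
  exact TensorProduct.ext' fun _ _ => rfl

/-- The monoidal structure on **qSet** given by the Cartesian product. -/
abbrev monoidal : MonoidalCategory QSet.{u} where
  toMonoidalCategoryStruct := cartesian
  tensorHom_def F G := by
    change prodMap F G = prodMap F (𝟙 _) ≫ prodMap (𝟙 _) G
    rw [prodMap_comp, Category.comp_id, Category.id_comp]
  id_tensorHom_id := prodMap_id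
  tensorHom_comp_tensorHom F G F' G' := prodMap_comp F F' G G'
  whiskerLeft_id := prodMap_id
  id_whiskerRight := prodMap_id
  associator_naturality := associator_naturality
  leftUnitor_naturality := leftUnitor_naturality
  rightUnitor_naturality := rightUnitor_naturality
  pentagon := pentagon
  triangle := triangle

/-- The symmetric monoidal structure on **qSet**. -/
abbrev symmetric : @SymmetricCategory QSet.{u} _ monoidal :=
  letI := monoidal.{u}
  { braiding := symmetry
    braiding_naturality_right := fun X _ _ F => symmetry_naturality (𝟙 X) F
    braiding_naturality_left := fun F Z => symmetry_naturality F (𝟙 Z)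
    hexagon_forward := hexagon
    hexagon_reverse := hexagon_symm
    symmetry := symmetry_comp_symmetry }

end QSet

/-! ### Projections in self-adjoint algebras of operators -/

section Projection

open Polynomial

/-- `X - z` divides `q - q(z)`, and `a - z` annihilates `b`. -/
theorem aeval_mul_eq_eval_smul {A : Type*} [Ring A] [Algebra ℂ A] {a b : A} {z : ℂ}
    (h : a * b = z • b) (q : ℂ[X]) : aeval a q * b = q.eval z • b := by
  obtain ⟨r, hr⟩ := X_sub_C_dvd_sub_C_eval (a := z) (p := q)
  have h1 : aeval a q = aeval a r * (a - algebraMap ℂ A z) + algebraMap ℂ A (q.eval z) := by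
    rw [← sub_eq_iff_eq_add]
    simpa [mul_comm] using congrArg (aeval a) (hr.trans (mul_comm _ _))
  rw [h1, add_mul, mul_assoc, sub_mul, h, ← Algebra.smul_def, ← Algebra.smul_def, sub_self,
    mul_zero, zero_add]

theorem mul_aeval_eq_eval_smul {A : Type*} [Ring A] [Algebra ℂ A] {a b : A} {z : ℂ}
    (h : b * a = z • b) (q : ℂ[X]) : b * aeval a q = q.eval z • b := by
  obtain ⟨r, hr⟩ := X_sub_C_dvd_sub_C_eval (a := z) (p := q)
  have h1 : aeval a q = (a - algebraMap ℂ A z) * aeval a r + algebraMap ℂ A (q.eval z) := by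
    rw [← sub_eq_iff_eq_add]
    simpa using congrArg (aeval a) hr
  rw [h1, mul_add, ← mul_assoc, mul_sub, h, ← Algebra.commutes, ← Algebra.commutes,
    ← Algebra.smul_def, ← Algebra.smul_def, sub_self, zero_mul, zero_add]

variable {E : Type*} [NormedAddCommGroup E] [InnerProductSpace ℂ E] [FiniteDimensional ℂ E]
  {F : Type*} [NormedAddCommGroup F] [InnerProductSpace ℂ F] [FiniteDimensional ℂ F]

/-- `‖f x‖² = ⟨f† f x, x⟩`. -/
theorem LinearMap.adjoint_comp_self_eq_zero {f : E →ₗ[ℂ] F}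
    (h : LinearMap.adjoint f ∘ₗ f = 0) : f = 0 := by
  ext x
  have := LinearMap.adjoint_inner_left f x (f x)
  rw [← LinearMap.comp_apply, h] at this
  simpa using this.symm

/-- Serves to reroute a factorization `a† b` through `E` along `v`, to an equivalent space `F`. -/
theorem LinearMap.adjoint_comp_eq_smul {D : Type*} [NormedAddCommGroup D] [InnerProductSpace ℂ D]
    [FiniteDimensional ℂ D] {v : E →ₗ[ℂ] F} {z : ℂ} (hz : z ≠ 0)
    (hv : LinearMap.adjoint v ∘ₗ v = z • LinearMap.id) (a b : D →ₗ[ℂ] E) :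
    LinearMap.adjoint a ∘ₗ b = z⁻¹ • (LinearMap.adjoint (v ∘ₗ a) ∘ₗ (v ∘ₗ b)) := by
  rw [LinearMap.adjoint_comp, LinearMap.comp_assoc, ← LinearMap.comp_assoc b, hv,
    LinearMap.smul_comp, LinearMap.id_comp, LinearMap.comp_smul, smul_smul,
    inv_mul_cancel₀ hz, one_smul]

/-- If `v + v†` and `i(v - v†)` were both scalars, so would be `v`. -/
theorem exists_isSelfAdjoint_not_scalar (A : Subalgebra ℂ (Module.End ℂ E))
    (hA : ∀ v ∈ A, star v ∈ A) {v : Module.End ℂ E} (hv : v ∈ A)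
    (hv' : ∀ z : ℂ, v ≠ z • 1) : ∃ a ∈ A, star a = a ∧ ∀ z : ℂ, a ≠ z • 1 := by
  by_contra! h
  obtain ⟨z, hz⟩ := h (v + star v) (add_mem hv (hA v hv)) (by simp [add_comm])
  obtain ⟨w, hw⟩ := h (Complex.I • (v - star v))
    (A.smul_mem (sub_mem hv (hA v hv)) _) (by simp [star_smul, ← smul_neg])
  refine hv' ((z - Complex.I * w) / 2) ?_
  have h1 : v - star v = -(Complex.I * w) • 1 := by
    rw [← neg_mul, ← smul_smul, ← hw, smul_smul]
    simp
  have h2 : (2 : ℂ) • v = (z - Complex.I * w) • 1 := by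
    rw [sub_smul, ← hz, sub_eq_add_neg, ← neg_smul, ← h1, two_smul]
    abel
  rw [div_eq_inv_mul, ← smul_smul, ← h2, smul_smul]
  simp

/-- For a self-adjoint nonscalar `a` with minimal polynomial `(X - z) q`, the operator `c = q(a)` is
nonzero and maps into the `z`-eigenspace. A multiple of `b = c c†` is the projection. -/
theorem exists_projection_mem (A : Subalgebra ℂ (Module.End ℂ E))
    (hA : ∀ v ∈ A, star v ∈ A) {v : Module.End ℂ E} (hv : v ∈ A)
    (hv' : ∀ z : ℂ, v ≠ z • 1) : ∃ p ∈ A, star p = p ∧ p * p = p ∧ p ≠ 0 ∧ p ≠ 1 := by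
  obtain ⟨a, ha, hsa, ha'⟩ := exists_isSelfAdjoint_not_scalar A hA hv hv'
  have hint : IsIntegral ℂ a := Algebra.IsIntegral.isIntegral a
  have : Nontrivial (Module.End ℂ E) := ⟨a, 0, by simpa using ha' 0⟩
  obtain ⟨z, hz⟩ := IsAlgClosed.exists_root (minpoly ℂ a) (minpoly.degree_pos hint).ne'
  obtain ⟨q, hq⟩ := dvd_iff_isRoot.2 hz
  have hq0 : q ≠ 0 := by
    rintro rfl
    exact minpoly.ne_zero hint (by simpa using hq)
  have hqa : aeval a q ≠ 0 := by
    intro h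
    have h1 := minpoly.degree_le_of_ne_zero ℂ a hq0 h
    rw [hq, degree_mul, degree_X_sub_C, degree_eq_natDegree hq0] at h1
    norm_cast at h1
    omega
  set c := aeval a q with hc
  have hcA : c ∈ A := by
    rw [hc, ← aeval_subalgebra_coe q A ⟨a, ha⟩]
    exact Subtype.coe_prop _
  have hac : a * c = z • c := by
    have := congrArg (aeval a) hq
    rw [minpoly.aeval] at this
    simp only [map_mul, map_sub, aeval_X, aeval_C, ← hc, sub_mul] at this
    rw [Algebra.smul_def]
    exact (sub_eq_zero.1 this.symm)
  -- `c` is not known to be self-adjoint, since `z` is not shown to be real; `c c†` is.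
  set b := c * star c with hb
  have hbs : star b = b := by simp [hb]
  have hb0 : b ≠ 0 := by
    intro h
    apply hqa
    have : LinearMap.adjoint c = 0 := LinearMap.adjoint_comp_self_eq_zero (by
      rw [LinearMap.adjoint_adjoint]; exact h)
    rw [← LinearMap.adjoint_adjoint c, this, map_zero]
  have hab : a * b = z • b := by rw [hb, ← mul_assoc, hac, smul_mul_assoc]
  have hba : b * a = star z • b := by
    have := congrArg star hab
    rwa [star_mul, hbs, hsa, star_smul, hbs] at this
  have h1 : c * b = q.eval z • b := aeval_mul_eq_eval_smul hab q
  have h2 : b * c = q.eval (star z) • b := mul_aeval_eq_eval_smul hba q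
  have h3 : star c * b = star (q.eval (star z)) • b := by
    have := congrArg star h2
    rwa [star_mul, hbs, star_smul, hbs] at this
  -- Both `c` and `c†` act on `b` by scalars, hence so does `b = c c†`.
  obtain ⟨w, hw⟩ : ∃ w : ℂ, b * b = w • b := by
    refine ⟨star (q.eval (star z)) * q.eval z, ?_⟩
    nth_rewrite 1 [hb]
    rw [mul_assoc, h3, mul_smul_comm, h1, smul_smul]
  have hw0 : w ≠ 0 := by
    rintro rfl
    rw [zero_smul] at hw
    exact hb0 (LinearMap.adjoint_comp_self_eq_zero (by
      rw [← LinearMap.star_eq_adjoint, hbs]; exact hw))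
  have hws : star w = w := by
    have := congrArg star hw
    rw [star_mul, hbs, hw, star_smul, hbs] at this
    exact (smul_left_injective ℂ hb0 this).symm
  refine ⟨w⁻¹ • b, A.smul_mem (A.mul_mem hcA (hA c hcA)) _, ?_, ?_, ?_, ?_⟩
  · rw [star_smul, hbs, star_inv₀, hws]
  · rw [smul_mul_smul_comm, hw, smul_smul, mul_assoc, inv_mul_cancel₀ hw0, mul_one]
  · exact smul_ne_zero (inv_ne_zero hw0) hb0
  · intro h
    -- If the projection were `1`, then `a` would be the scalar `z`, as `a b = z b`.
    apply ha' z
    rw [← mul_one a, ← h, mul_smul_comm, hab, smul_comm]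

/-- A projection is of the form `j j†` for an isometry `j` defined on some `ℂⁿ⁺¹`. -/
theorem exists_isometry_of_projection {p : Module.End ℂ E} (hs : star p = p) (hp : p * p = p)
    (h0 : p ≠ 0) : ∃ (n : ℕ) (j : EuclideanSpace ℂ (ULift.{u} (Fin (n + 1))) →ₗ[ℂ] E),
      LinearMap.adjoint j ∘ₗ j = LinearMap.id ∧ j ∘ₗ LinearMap.adjoint j = p ∧
        n + 1 = Module.finrank ℂ (LinearMap.range p) := by
  have hpos : Module.finrank ℂ (LinearMap.range p) ≠ 0 := by
    rw [Ne, Submodule.finrank_eq_zero, LinearMap.range_eq_bot]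
    exact h0
  obtain ⟨n, hn⟩ := Nat.exists_eq_succ_of_ne_zero hpos
  let u : EuclideanSpace ℂ (ULift.{u} (Fin (n + 1))) ≃ₗᵢ[ℂ] LinearMap.range p :=
    ((stdOrthonormalBasis ℂ (LinearMap.range p)).reindex
      ((finCongr hn).trans Equiv.ulift.symm)).repr.symm
  -- As `p` is a self-adjoint idempotent, corestricting it to its range gives the adjoint of the
  -- inclusion.
  have hsub : LinearMap.adjoint (LinearMap.range p).subtype = p.rangeRestrict := by
    symm
    rw [LinearMap.eq_adjoint_iff]
    rintro x ⟨y, z, rfl⟩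
    change inner ℂ (p x) (p z) = inner ℂ x (p z)
    rw [← LinearMap.adjoint_inner_right, ← LinearMap.star_eq_adjoint, hs]
    exact congrArg (inner ℂ x) (LinearMap.congr_fun hp z)
  refine ⟨n, (LinearMap.range p).subtype ∘ₗ u.toLinearEquiv.toLinearMap, ?_, ?_, hn.symm⟩
  · rw [LinearMap.adjoint_comp, QuantumSet.adjoint_unitary, hsub]
    ext1 x
    obtain ⟨z, hz⟩ := (u x).2
    have : p.rangeRestrict (u x) = u x := by
      ext
      change p (u x) = u x
      rw [← hz]
      exact LinearMap.congr_fun hp z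
    change u.symm (p.rangeRestrict (u x)) = x
    rw [this, u.symm_apply_apply]
  · rw [LinearMap.adjoint_comp, QuantumSet.adjoint_unitary, hsub]
    ext x
    change ((u (u.symm (p.rangeRestrict x)) : LinearMap.range p) : E) = p x
    rw [u.apply_symm_apply]
    rfl

theorem finrank_range_lt_of_projection {p : Module.End ℂ E} (hp : p * p = p) (h1 : p ≠ 1) :
    Module.finrank ℂ (LinearMap.range p) < Module.finrank ℂ E := by
  refine Submodule.finrank_lt fun h => h1 ?_
  ext x
  obtain ⟨y, rfl⟩ := LinearMap.range_eq_top.1 h x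
  exact LinearMap.congr_fun hp y

end Projection

/-! ### Compatible operators and actions -/

namespace QuantumSet

variable {W W' W'' X Y : QuantumSet.{u}}

/-- The residual of `G` by `G'`: the largest relation `R` with `G' ∘ (R × I) ≤ G`, see
`Rel.le_residual_iff`. -/
def Rel.residual (G : Rel (W.prod X) Y) (G' : Rel (W'.prod X) Y) : Rel W W' := fun w w' =>
  { carrier := {v | ∀ x y, ∀ f ∈ G' (w', x) y, f ∘ₗ TensorProduct.map v LinearMap.id ∈ G (w, x) y}
    zero_mem' := fun x y f _ => by
      rw [TensorProduct.map_zero_left, LinearMap.comp_zero]; exact zero_mem _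
    add_mem' := fun hv hv' x y f hf => by
      rw [TensorProduct.map_add_left, LinearMap.comp_add]
      exact add_mem (hv x y f hf) (hv' x y f hf)
    smul_mem' := fun z v hv x y f hf => by
      rw [TensorProduct.map_smul_left, LinearMap.comp_smul]
      exact Submodule.smul_mem _ z (hv x y f hf) }

theorem Rel.dagger_id (X : QuantumSet.{u}) : (Rel.id X).dagger = Rel.id X := by
  have h : Rel.id X ≤ (Rel.id X).dagger := ofMaps_le fun a => by
    rw [mem_dagger, LinearMap.adjoint_id]
    exact id_mem a
  refine le_antisymm ?_ h
  have := dagger_mono h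
  rwa [dagger_dagger] at this

theorem Rel.le_residual_iff {G : Rel (W.prod X) Y} {G' : Rel (W'.prod X) Y} {R : Rel W W'} :
    R ≤ Rel.residual G G' ↔ Rel.comp (Rel.prod R (Rel.id X)) G' ≤ G := by
  constructor
  · intro h
    refine comp_le ?_
    intro a b y s hs r hr
    refine prod_induction (p := a) (q := b) (LinearMap.compRight ℂ s) (G a y) ?_ r hr
    intro r hr t ht
    refine ofMaps_induction (P := fun x x' t => ∀ s : W'.H b.1 ⊗[ℂ] X.H x' →ₗ[ℂ] Y.H y,
      s ∈ G' (b.1, x') y → s ∘ₗ TensorProduct.map r t ∈ G (a.1, x) y)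
      ?_ ?_ ?_ ?_ a.2 b.2 t ht s hs
    · exact fun x s hs => h a.1 b.1 hr x y s hs
    · intro x x' s _
      rw [TensorProduct.map_zero_right, LinearMap.comp_zero]; exact zero_mem _
    · intro x x' v w hv hw s hs
      rw [TensorProduct.map_add_right, LinearMap.comp_add]; exact add_mem (hv s hs) (hw s hs)
    · intro x x' z v hv s hs
      rw [TensorProduct.map_smul_right, LinearMap.comp_smul]
      exact Submodule.smul_mem _ _ (hv s hs)
  · intro h w w' v hv x y f hf
    exact h (w, x) y (comp_mem (b := (w', x)) hf (prod_mem hv (id_mem x)))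

/-- With `P = R × I` and `G' ∘ P ≤ G`, one has `G ∘ P† ≤ G ∘ P† ∘ G'† ∘ G' = G ∘ (G' ∘ P)† ∘ G' ≤ G
∘ G† ∘ G' ≤ G'`. This is what makes the endomorphisms a self-adjoint algebra. -/
theorem Rel.dagger_residual_le {G : Rel (W.prod X) Y} {G' : Rel (W'.prod X) Y}
    (hG : G.IsFunction) (hG' : G'.IsFunction) :
    (Rel.residual G G').dagger ≤ Rel.residual G' G := by
  rw [le_residual_iff]
  have h := le_residual_iff.1 (le_refl (Rel.residual G G'))
  have h' : (Rel.prod (Rel.residual G G') (Rel.id X)).dagger =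
      Rel.prod (Rel.residual G G').dagger (Rel.id X) := by
    rw [prod_dagger, dagger_id]
  rw [← h']
  set P := Rel.prod (Rel.residual G G') (Rel.id X)
  calc Rel.comp P.dagger G = Rel.comp (Rel.id _) (Rel.comp P.dagger G) := (id_comp _).symm
    _ ≤ Rel.comp (Rel.comp G' G'.dagger) (Rel.comp P.dagger G) := comp_mono hG'.1 le_rfl
    _ = Rel.comp G' (Rel.comp (Rel.comp P G').dagger G) := by
      simp only [comp_assoc, dagger_comp]
    _ ≤ Rel.comp G' (Rel.comp G.dagger G) :=
      comp_mono le_rfl (comp_mono (dagger_mono h) le_rfl)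
    _ ≤ Rel.comp G' (Rel.id Y) := comp_mono le_rfl hG.2
    _ = G' := comp_id G'

theorem Rel.adjoint_mem_residual {G : Rel (W.prod X) Y} {G' : Rel (W'.prod X) Y}
    (hG : G.IsFunction) (hG' : G'.IsFunction) {w w'} {v : W.H w →ₗ[ℂ] W'.H w'}
    (hv : v ∈ Rel.residual G G' w w') : LinearMap.adjoint v ∈ Rel.residual G' G w' w :=
  dagger_residual_le hG hG' w' w (adjoint_mem_dagger hv)

theorem Rel.comp_mem_residual {G : Rel (W.prod X) Y} {G' : Rel (W'.prod X) Y}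
    {G'' : Rel (W''.prod X) Y} {w w' w''} {v : W.H w →ₗ[ℂ] W'.H w'} {v' : W'.H w' →ₗ[ℂ] W''.H w''}
    (hv' : v' ∈ Rel.residual G' G'' w' w'') (hv : v ∈ Rel.residual G G' w w') :
    v' ∘ₗ v ∈ Rel.residual G G'' w w'' := by
  intro x y f hf
  have h : TensorProduct.map (v' ∘ₗ v) (LinearMap.id : X.H x →ₗ[ℂ] X.H x) =
      TensorProduct.map v' LinearMap.id ∘ₗ TensorProduct.map v LinearMap.id := by
    rw [← TensorProduct.map_comp, LinearMap.id_comp]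
  rw [h, ← LinearMap.comp_assoc]
  exact hv x y _ (hv' x y f hf)

theorem Rel.id_mem_residual (G : Rel (W.prod X) Y) (w : W.At) :
    LinearMap.id ∈ Rel.residual G G w w := by
  intro x y f hf
  rwa [TensorProduct.map_id, LinearMap.comp_id]

/-- The algebra of the endomorphisms of the atom `w` that are compatible with `G`. -/
def Rel.endomorphisms (G : Rel (W.prod X) Y) (w : W.At) : Subalgebra ℂ (Module.End ℂ (W.H w)) where
  carrier := {v | v ∈ Rel.residual G G w w}
  zero_mem' := (Rel.residual G G w w).zero_mem
  one_mem' := Rel.id_mem_residual G w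
  add_mem' := (Rel.residual G G w w).add_mem
  mul_mem' := Rel.comp_mem_residual
  algebraMap_mem' z := by
    rw [Algebra.algebraMap_eq_smul_one]
    exact Submodule.smul_mem _ z (Rel.id_mem_residual G w)

/-- A family of subspaces of operators defined on a Hilbert space `H` satisfies the conditions on
the values of a function at an atom. -/
def IsFunctionAt {H : Type u} [NormedAddCommGroup H] [InnerProductSpace ℂ H]
    [FiniteDimensional ℂ H] (R : ∀ b, Submodule ℂ (H →ₗ[ℂ] Y.H b)) : Prop :=
  LinearMap.id ∈ Submodule.span ℂ {t : H →ₗ[ℂ] H | ∃ b, ∃ s ∈ R b, ∃ r ∈ R b,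
    t = LinearMap.adjoint s ∘ₗ r} ∧
  ∀ b b', ∀ r ∈ R b, ∀ s ∈ R b', s ∘ₗ LinearMap.adjoint r ∈ Rel.id Y b b'

/-- Neither inequality couples different atoms of the source. Functions can therefore be restricted
to a single atom and collected over arbitrary families of atoms. -/
theorem Rel.isFunction_iff {F : Rel X Y} : F.IsFunction ↔ ∀ a, IsFunctionAt (F a) := by
  have hspan : ∀ a, {t : X.H a →ₗ[ℂ] X.H a | ∃ b, ∃ s ∈ F.dagger b a, ∃ r ∈ F a b, t = s ∘ₗ r} =
      {t | ∃ b, ∃ s ∈ F a b, ∃ r ∈ F a b, t = LinearMap.adjoint s ∘ₗ r} := by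
    intro a
    ext t
    constructor
    · rintro ⟨b, s, hs, r, hr, rfl⟩
      exact ⟨b, _, mem_dagger.1 hs, r, hr, by rw [LinearMap.adjoint_adjoint]⟩
    · rintro ⟨b, s, hs, r, hr, rfl⟩
      exact ⟨b, _, adjoint_mem_dagger hs, r, hr, rfl⟩
  constructor
  · intro h a
    refine ⟨?_, fun b b' r hr s hs => h.2 b b' (comp_mem hs (adjoint_mem_dagger hr))⟩
    rw [← hspan]
    exact h.1 a a (id_mem a)
  · intro h
    refine ⟨ofMaps_le fun a => ?_, comp_le fun b a b' s hs r hr => ?_⟩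
    · have := (h a).1
      rwa [← hspan] at this
    · have := (h a).2 b b' _ (mem_dagger.1 hr) s hs
      rwa [LinearMap.adjoint_adjoint] at this

/-- The restriction of a function along an isometry `j` of Hilbert spaces such that `j j†` is
compatible with the function. -/
theorem IsFunctionAt.restrict {H K : Type u} [NormedAddCommGroup H] [InnerProductSpace ℂ H]
    [FiniteDimensional ℂ H] [NormedAddCommGroup K] [InnerProductSpace ℂ K]
    [FiniteDimensional ℂ K] {R : ∀ b, Submodule ℂ (H →ₗ[ℂ] Y.H b)} (hR : IsFunctionAt R)
    (j : K →ₗ[ℂ] H) (hj : LinearMap.adjoint j ∘ₗ j = LinearMap.id)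
    (hj' : ∀ b, ∀ r ∈ R b, r ∘ₗ (j ∘ₗ LinearMap.adjoint j) ∈ R b) :
    IsFunctionAt fun b => (R b).map (LinearMap.lcomp ℂ (Y.H b) j) := by
  constructor
  · rw [← hj]
    -- The compression `t ↦ j† t j` sends `s† r` to `(s j)† (r j)`.
    have key : ∀ t : H →ₗ[ℂ] H,
        t ∈ Submodule.span ℂ {t : H →ₗ[ℂ] H | ∃ b, ∃ s ∈ R b, ∃ r ∈ R b,
          t = LinearMap.adjoint s ∘ₗ r} → LinearMap.adjoint j ∘ₗ t ∘ₗ j ∈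
        Submodule.span ℂ {t : K →ₗ[ℂ] K | ∃ b, ∃ s ∈ (R b).map (LinearMap.lcomp ℂ (Y.H b) j),
          ∃ r ∈ (R b).map (LinearMap.lcomp ℂ (Y.H b) j), t = LinearMap.adjoint s ∘ₗ r} := by
      intro t ht
      induction ht using Submodule.span_induction with
      | mem t ht =>
        obtain ⟨b, s, hs, r, hr, rfl⟩ := ht
        refine Submodule.subset_span ⟨b, s ∘ₗ j, ⟨s, hs, rfl⟩, r ∘ₗ j, ⟨r, hr, rfl⟩, ?_⟩
        rw [LinearMap.adjoint_comp]
        rfl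
      | zero => simp
      | add x y _ _ hx hy =>
        rw [LinearMap.add_comp, LinearMap.comp_add]; exact add_mem hx hy
      | smul z x _ hx =>
        rw [LinearMap.smul_comp, LinearMap.comp_smul]; exact Submodule.smul_mem _ _ hx
    have := key _ hR.1
    rwa [LinearMap.id_comp] at this
  · rintro b b' _ ⟨r, hr, rfl⟩ _ ⟨s, hs, rfl⟩
    -- `(s j)(r j)† = (s j j†) r†`, where `s j j†` lies in `R b'` again.
    have := hR.2 b b' r hr _ (hj' b' s hs)
    change (s ∘ₗ j) ∘ₗ LinearMap.adjoint (r ∘ₗ j) ∈ _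
    rw [LinearMap.adjoint_comp]
    exact this

/-- The quantum set of all functions to `Y` from the product with `X` of a single atom `ℂⁿ⁺¹`. -/
abbrev actions (X Y : QuantumSet.{u}) : QuantumSet.{u} where
  -- The concrete models `ℂⁿ⁺¹` make the actions a set in the universe `u`, and `n + 1` excludes the
  -- zero space.
  At := Σ n : ℕ, {F : ∀ x y, Submodule ℂ
    (EuclideanSpace ℂ (ULift.{u} (Fin (n + 1))) ⊗[ℂ] X.H x →ₗ[ℂ] Y.H y) //
      ∀ x, IsFunctionAt (F x)}
  H t := EuclideanSpace ℂ (ULift.{u} (Fin (t.1 + 1)))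
  normed _ := inferInstance
  innerProductSpace _ := inferInstance
  finiteDimensional _ := inferInstance
  nontrivial _ := inferInstance

/-- The evaluation of actions. -/
def actionsEval (X Y : QuantumSet.{u}) : Rel ((actions X Y).prod X) Y := fun p y => p.1.2.1 p.2 y

theorem isFunction_actionsEval (X Y : QuantumSet.{u}) : (actionsEval X Y).IsFunction :=
  Rel.isFunction_iff.2 fun p => p.1.2.2 p.2

/-- A compatible projection `j j†` cuts out a subobject: restricting `G` along `j` gives an action,
and `k = j†` is compatible with it. -/
theorem exists_action {G : Rel (W.prod X) Y} (hG : G.IsFunction) (w : W.At) {n : ℕ}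
    (j : EuclideanSpace ℂ (ULift.{u} (Fin (n + 1))) →ₗ[ℂ] W.H w)
    (hj : LinearMap.adjoint j ∘ₗ j = LinearMap.id)
    (hj' : j ∘ₗ LinearMap.adjoint j ∈ Rel.residual G G w w) :
    ∃ t : (actions X Y).At, t.1 = n ∧ ∃ k ∈ Rel.residual G (actionsEval X Y) w t,
      LinearMap.adjoint k ∘ₗ k = j ∘ₗ LinearMap.adjoint j := by
  have h1 : ∀ x, LinearMap.adjoint (TensorProduct.map j (LinearMap.id : X.H x →ₗ[ℂ] X.H x)) =
      TensorProduct.map (LinearMap.adjoint j) LinearMap.id := by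
    intro x
    rw [TensorProduct.adjoint_map, LinearMap.adjoint_id]
  have h2 : ∀ x, TensorProduct.map j (LinearMap.id : X.H x →ₗ[ℂ] X.H x) ∘ₗ
      TensorProduct.map (LinearMap.adjoint j) LinearMap.id =
      TensorProduct.map (j ∘ₗ LinearMap.adjoint j) LinearMap.id := by
    intro x
    rw [← TensorProduct.map_comp, LinearMap.id_comp]
  have hF : ∀ x, IsFunctionAt (Y := Y) fun y => (G (w, x) y).map
      (LinearMap.lcomp ℂ (Y.H y) (TensorProduct.map j (LinearMap.id : X.H x →ₗ[ℂ] X.H x))) := by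
    intro x
    refine IsFunctionAt.restrict (Rel.isFunction_iff.1 hG (w, x)) _ ?_ ?_
    · rw [h1, ← TensorProduct.map_comp, hj, LinearMap.id_comp, TensorProduct.map_id]
    · intro y f hf
      rw [h1, h2]
      exact hj' x y f hf
  refine ⟨⟨n, _, hF⟩, rfl, LinearMap.adjoint j, ?_, ?_⟩
  · rintro x y _ ⟨f, hf, rfl⟩
    change (f ∘ₗ TensorProduct.map j LinearMap.id) ∘ₗ
      TensorProduct.map (LinearMap.adjoint j) LinearMap.id ∈ _
    rw [LinearMap.comp_assoc, h2]
    exact hj' x y f hf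
  · exact congrArg (· ∘ₗ LinearMap.adjoint j) (LinearMap.adjoint_adjoint j)

end QuantumSet

/-! ### Irreducible actions, complete reducibility and the function set -/

namespace QuantumSet

variable {W X Y : QuantumSet.{u}}

/-- An action is irreducible if all its endomorphisms are scalars. -/
def IsIrreducible (t : (actions X Y).At) : Prop :=
  ∀ v ∈ Rel.residual (actionsEval X Y) (actionsEval X Y) t t, ∃ z : ℂ, v = z • LinearMap.id

theorem adjoint_mem_residual_actionsEval {s t : (actions X Y).At}
    {v : (actions X Y).H s →ₗ[ℂ] (actions X Y).H t}
    (hv : v ∈ Rel.residual (actionsEval X Y) (actionsEval X Y) s t) :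
    LinearMap.adjoint v ∈ Rel.residual (actionsEval X Y) (actionsEval X Y) t s :=
  Rel.adjoint_mem_residual (isFunction_actionsEval X Y) (isFunction_actionsEval X Y) hv

/-- The part of the endomorphism algebra of the atom `w` that factors through irreducible
actions. -/
def irreduciblePart (G : Rel (W.prod X) Y) (w : W.At) : Submodule ℂ (W.H w →ₗ[ℂ] W.H w) :=
  Submodule.span ℂ {r | ∃ t : (actions X Y).At, IsIrreducible t ∧
    ∃ a ∈ Rel.residual G (actionsEval X Y) w t, ∃ b ∈ Rel.residual G (actionsEval X Y) w t,
      r = LinearMap.adjoint a ∘ₗ b}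

/-- Factorizations pull back along `k`, since `k† (a† b) k = (a k)† (b k)`. -/
theorem adjoint_comp_mem_irreduciblePart {G : Rel (W.prod X) Y} {w : W.At}
    {t : (actions X Y).At} {k : W.H w →ₗ[ℂ] (actions X Y).H t}
    (hk : k ∈ Rel.residual G (actionsEval X Y) w t)
    {r : (actions X Y).H t →ₗ[ℂ] (actions X Y).H t}
    (hr : r ∈ irreduciblePart (actionsEval X Y) t) :
    LinearMap.adjoint k ∘ₗ r ∘ₗ k ∈ irreduciblePart G w := by
  induction hr using Submodule.span_induction with
  | mem r hr =>
    obtain ⟨s, hs, a, ha, b, hb, rfl⟩ := hr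
    refine Submodule.subset_span ⟨s, hs, a ∘ₗ k, Rel.comp_mem_residual ha hk, b ∘ₗ k,
      Rel.comp_mem_residual hb hk, ?_⟩
    rw [LinearMap.adjoint_comp]
    rfl
  | zero => rw [LinearMap.zero_comp, LinearMap.comp_zero]; exact zero_mem _
  | add x y _ _ hx hy => rw [LinearMap.add_comp, LinearMap.comp_add]; exact add_mem hx hy
  | smul z x _ hx =>
    rw [LinearMap.smul_comp, LinearMap.comp_smul]; exact Submodule.smul_mem _ _ hx

/-- Every action is a direct sum of irreducible actions. -/
theorem id_mem_irreduciblePart_actionsEval (t : (actions X Y).At) :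
    LinearMap.id ∈ irreduciblePart (actionsEval X Y) t := by
  obtain ⟨n, hn⟩ : ∃ n, t.1 = n := ⟨_, rfl⟩
  induction n using Nat.strong_induction_on generalizing t with
  | _ n ih =>
  by_cases ht : IsIrreducible t
  · refine Submodule.subset_span ⟨t, ht, _, Rel.id_mem_residual _ t, _,
      Rel.id_mem_residual _ t, ?_⟩
    rw [LinearMap.adjoint_id, LinearMap.id_comp]
  unfold IsIrreducible at ht
  push Not at ht
  obtain ⟨v, hv, hv'⟩ := ht
  obtain ⟨p, hpA, hps, hpp, hp0, hp1⟩ := exists_projection_mem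
    (Rel.endomorphisms (actionsEval X Y) t) (fun v hv => adjoint_mem_residual_actionsEval hv) hv hv'
  -- A proper nonzero projection splits through an action of smaller dimension, covered by the
  -- induction hypothesis. This is applied to `p` and `1 - p`, whose sum is the identity.
  have key : ∀ p ∈ Rel.endomorphisms (actionsEval X Y) t, star p = p → p * p = p → p ≠ 0 →
      p ≠ 1 → p ∈ irreduciblePart (actionsEval X Y) t := by
    intro p hpA hps hpp hp0 hp1
    obtain ⟨m, j, hj, hj', hm⟩ := exists_isometry_of_projection hps hpp hp0
    have hlt := finrank_range_lt_of_projection hpp hp1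
    rw [← hm, finrank_euclideanSpace, Fintype.card_ulift, Fintype.card_fin] at hlt
    obtain ⟨s, hs, k, hk, hk'⟩ := exists_action (isFunction_actionsEval X Y) t j hj
      (by rw [hj']; exact hpA)
    have := adjoint_comp_mem_irreduciblePart hk (ih m (by omega) s hs)
    rwa [LinearMap.id_comp, hk', hj'] at this
  have h := add_mem (key p hpA hps hpp hp0 hp1)
    (key (1 - p) (sub_mem (one_mem _) hpA) (by rw [star_sub, star_one, hps])
      (by rw [mul_sub, sub_mul, sub_mul, hpp]; simp) (sub_ne_zero.2 hp1.symm)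
      (by simpa using hp0))
  rw [add_sub_cancel] at h
  exact h

theorem id_mem_irreduciblePart {G : Rel (W.prod X) Y} (hG : G.IsFunction) (w : W.At) :
    LinearMap.id ∈ irreduciblePart G w := by
  -- The projection `1` identifies the whole atom with some `ℂⁿ⁺¹`, hence with an action.
  obtain ⟨n, j, hj, hj', -⟩ := exists_isometry_of_projection (E := W.H w) (p := 1) (star_one _)
    (mul_one 1) one_ne_zero
  obtain ⟨t, -, k, hk, hk'⟩ := exists_action hG w j hj (by
    rw [hj']; exact Rel.id_mem_residual G w)
  have := adjoint_comp_mem_irreduciblePart hk (id_mem_irreduciblePart_actionsEval t)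
  rwa [LinearMap.id_comp, hk', hj'] at this

/-- Schur's lemma: `v† v` is an endomorphism of `s`, hence a scalar, and it vanishes only if `v`
does. -/
theorem IsIrreducible.adjoint_comp_self {s t : (actions X Y).At} (hs : IsIrreducible s)
    {v : (actions X Y).H s →ₗ[ℂ] (actions X Y).H t}
    (hv : v ∈ Rel.residual (actionsEval X Y) (actionsEval X Y) s t) (h0 : v ≠ 0) :
    ∃ z : ℂ, z ≠ 0 ∧ LinearMap.adjoint v ∘ₗ v = z • LinearMap.id := by
  obtain ⟨z, hz⟩ := hs _ (Rel.comp_mem_residual (adjoint_mem_residual_actionsEval hv) hv)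
  refine ⟨z, ?_, hz⟩
  rintro rfl
  exact h0 (LinearMap.adjoint_comp_self_eq_zero (by rw [hz, zero_smul]))

/-- Irreducible actions are equivalent if there is a nonzero operator between them that is
compatible with the evaluation. -/
instance irreducibleSetoid (X Y : QuantumSet.{u}) :
    Setoid {t : (actions X Y).At // IsIrreducible t} where
  r s t := ∃ v ∈ Rel.residual (actionsEval X Y) (actionsEval X Y) s.1 t.1, v ≠ 0
  iseqv :=
    { refl := fun s => ⟨LinearMap.id, Rel.id_mem_residual _ _,
        one_ne_zero (α := Module.End ℂ ((actions X Y).H s.1))⟩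
      symm := fun {s t} ⟨v, hv, h0⟩ => ⟨LinearMap.adjoint v, adjoint_mem_residual_actionsEval hv,
        by simpa using h0⟩
      trans := fun {r s t} ⟨v, hv, h0⟩ ⟨v', hv', h0'⟩ => by
        refine ⟨v' ∘ₗ v, Rel.comp_mem_residual hv' hv, fun h => ?_⟩
        -- `v'` is injective, because `v'† v'` is a nonzero scalar.
        obtain ⟨z, hz, hz'⟩ := s.2.adjoint_comp_self hv' h0'
        have h1 : LinearMap.adjoint v' ∘ₗ (v' ∘ₗ v) = z • v := by
          rw [← LinearMap.comp_assoc, hz', LinearMap.smul_comp, LinearMap.id_comp]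
        rw [h, LinearMap.comp_zero] at h1
        exact smul_ne_zero hz h0 h1.symm }

/-- The quantum function set `Y ^ X`, whose atoms are the equivalence classes of irreducible
actions. -/
abbrev functionSet (X Y : QuantumSet.{u}) : QuantumSet.{u} where
  At := Quotient (irreducibleSetoid X Y)
  H c := (actions X Y).H c.out.1
  normed _ := inferInstance
  innerProductSpace _ := inferInstance
  finiteDimensional _ := inferInstance
  nontrivial _ := inferInstance

/-- The evaluation `Y ^ X × X → Y`. -/
def eval (X Y : QuantumSet.{u}) : Rel ((functionSet X Y).prod X) Y :=
  fun p y => actionsEval X Y (p.1.out.1, p.2) y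

theorem isFunction_eval (X Y : QuantumSet.{u}) : (eval X Y).IsFunction :=
  Rel.isFunction_iff.2 fun p => p.1.out.1.2.2 p.2

/-- The function `W → Y ^ X` that corresponds to a function `G : W × X → Y`. -/
theorem isFunction_residual_eval {G : Rel (W.prod X) Y} (hG : G.IsFunction) :
    (Rel.residual G (eval X Y)).IsFunction := by
  constructor
  · refine Rel.ofMaps_le fun w => ?_
    refine Submodule.span_le.2 ?_ (id_mem_irreduciblePart hG w)
    rintro _ ⟨t, ht, a, ha, b, hb, rfl⟩
    -- `v` leads from `t` to the chosen representative of its class, which is an atom of the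
    -- function set; `a† b` is rerouted along it.
    obtain ⟨v, hv, h0⟩ := Setoid.symm (Quotient.mk_out (s := irreducibleSetoid X Y) ⟨t, ht⟩)
    obtain ⟨z, hz, hz'⟩ := ht.adjoint_comp_self hv h0
    rw [SetLike.mem_coe, LinearMap.adjoint_comp_eq_smul hz hz' a b]
    refine Submodule.smul_mem _ _ ?_
    exact Rel.comp_mem (X := W) (Y := functionSet X Y) (Z := W) (R := Rel.residual G (eval X Y))
      (b := (Quotient.mk (irreducibleSetoid X Y) ⟨t, ht⟩ : (functionSet X Y).At))
      (Rel.adjoint_mem_dagger (R := Rel.residual G (eval X Y)) (Rel.comp_mem_residual hv ha))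
      (Rel.comp_mem_residual hv hb)
  · refine Rel.comp_le fun c w c' s hs r hr => ?_
    have h : s ∘ₗ r ∈ Rel.residual (eval X Y) (eval X Y) c c' :=
      Rel.comp_mem_residual hs (Rel.dagger_residual_le hG (isFunction_eval X Y) c w hr)
    -- On one atom, irreducibility makes `s r` a scalar. Between distinct atoms it vanishes, because
    -- each class has only one representative.
    by_cases hc : c = c'
    · subst hc
      obtain ⟨z, hz⟩ := c.out.2 _ h
      rw [hz]
      exact Submodule.smul_mem _ z (Rel.id_mem c)
    · have h0 : s ∘ₗ r = 0 := by
        by_contra h0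
        exact hc (Quotient.out_equiv_out.1 ⟨_, h, h0⟩)
      rw [h0]
      exact zero_mem _

end QuantumSet

/-! ### The universal property and the adjunction -/

namespace QSet

open QuantumSet

/-- The evaluation `Y ^ X × X → Y` is terminal among the functions to `Y` from a product with
`X`. -/
def isTerminalEval (X Y : QSet.{u}) :
    letI := monoidal.{u}
    Limits.IsTerminal (CostructuredArrow.mk (S := MonoidalCategory.tensorRight X)
      (Y := (⟨functionSet X.obj Y.obj⟩ : QSet.{u})) (T := Y)
      ⟨eval X.obj Y.obj, isFunction_eval X.obj Y.obj⟩) :=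
  letI := monoidal.{u}
  Limits.IsTerminal.ofUniqueHom
    (fun A => CostructuredArrow.homMk
      ⟨Rel.residual (X := X.obj) (Y := Y.obj) (W := A.left.obj) A.hom.hom (eval X.obj Y.obj),
        isFunction_residual_eval A.hom.property⟩
      -- The residual satisfies only an inclusion by construction, but between functions this is an
      -- equality.
      (hom_ext_of_le (Rel.le_residual_iff.1 le_rfl)))
    fun A f => by
      apply CostructuredArrow.hom_ext
      apply hom_ext_of_le
      -- Any mediating function lies below the residual, hence equals it.
      refine Rel.le_residual_iff.2 (le_of_eq ?_)
      exact congrArg InducedWideCategory.Hom.hom (CostructuredArrow.w f)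

end QSet

theorem mainTheorem7 :
    ∃ (M : MonoidalCategory QSet.{u}) (S : SymmetricCategory QSet.{u}),
      M.toMonoidalCategoryStruct = QSet.cartesian ∧
      (∀ X Y : QSet.{u}, HEq (S.braiding X Y) (QSet.symmetry X Y)) ∧
      ∀ X : QSet.{u}, (MonoidalCategory.tensorRight X).IsLeftAdjoint := by
  refine ⟨QSet.monoidal, QSet.symmetric, rfl, fun X Y => HEq.rfl, fun X => ?_⟩
  let _ := QSet.monoidal.{u}
  have : ∀ Y : QSet.{u}, Limits.HasTerminal
      (CostructuredArrow (MonoidalCategory.tensorRight X) Y) :=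
    fun Y => (QSet.isTerminalEval X Y).hasTerminal
  exact isLeftAdjoint_of_costructuredArrowTerminals _

end
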